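/- For a deletion probability $q\in(0,1)$, the trace of a bit string $\mathbf x\in\{0,1\}^n$ is the random string obtained by deleting each bit of $\mathbf x$ independently with probability $q$ and concatenating the remaining bits in order; let $\mathbf P_{\mathbf x}$ be the law of $T$ independent traces $\mathfrak X=(\tilde{\mathbf x}^{(1)},\dots,\tilde{\mathbf x}^{(T)})$ of $\mathbf x$, and let $\mathcal S$ be the set of all finite bit strings. Two strings $\mathbf x,\mathbf y\in\{0,1\}^n$ can be distinguished with probability at least $1-\varepsilon$ from $T$ traces if there is a function $G\colon\mathcal S^T\to\{0,1\}^n$ with $\mathbf P_{\mathbf x}[G(\mathfrak X)=\mathbf x]\ge 1-\varepsilon$ and $\mathbf P_{\mathbf y}[G(\mathfrak X)=\mathbf y]\ge 1-\varepsilon$. All $n$-bit strings can be reconstructed with probability at least $1-\varepsilon$ from $T$ traces if there is a function $G\colon\mathcal S^T\to\{0,1\}^n$ with $\mathbf P_{\mathbf x}[G(\mathfrak X)=\mathbf x]\ge 1-\varepsilon$ for all $\mathbf x\in\{0,1\}^n$. Theorem. For all $q\in(0,1)$ and $\varepsilon_0\in(0,1/2)$ there is a constant $c>0$ such that for all $\varepsilon\in(0,\varepsilon_0]$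 and all integers $n\ge 2$, with $$T_n:=\left\lceil \frac{c\,\log(1/\varepsilon)\,n^{5/4}}{\sqrt{\log n}}\right\rceil ,$$ the following hold. If the strings $$\mathbf x_n:=(01)^{n-1}\,10\,(01)^n,\qquad \mathbf y_n:=(01)^n\,10\,(01)^{n-1}$$ in $\{0,1\}^{4n}$ can be distinguished with probability at least $1-\varepsilon$ from $T$ traces, then $T\ge T_n$. Likewise, if all $n$-bit strings can be reconstructed with probability at least $1-\varepsilon$ from $T$ traces, then $T\ge T_n$. -/

import Mathlib

open MeasureTheory

noncomputable section

namespace TraceReconstruction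

/-- Bit strings of length `n`; `false` is the bit 0 and `true` is the bit 1. -/
abbrev BitString (n : ℕ) : Type := Fin n → Bool

/-- The string kept from `x` when exactly the bits at the positions `i` with `m i = true` are
retained (in their original order) and all the others are deleted. -/
def trace {n : ℕ} (x : BitString n) (m : Fin n → Bool) : List Bool :=
  ((List.finRange n).filter (fun i => m i)).map x

/-- The law of one retention indicator: `true` (the bit is retained) with probability `1 - q` and
`false` (the bit is deleted) with probability `q`. -/
def retention (q : ℝ) : Measure Bool :=
  ENNReal.ofReal (1 - q) • Measure.dirac true + ENNReal.ofReal q • Measure.dirac false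

theorem isProbabilityMeasure_retention {q : ℝ} (h0 : 0 ≤ q) (h1 : q ≤ 1) :
    IsProbabilityMeasure (retention q) := by
  constructor
  simp [retention, ← ENNReal.ofReal_add (sub_nonneg.2 h1) h0]

/-- The joint law of the retention indicators for `T` independent passes of an `n`-bit string
through the deletion channel: all `T * n` indicators are independent. -/
def channel (q : ℝ) (T n : ℕ) : Measure (Fin T → Fin n → Bool) :=
  Measure.pi fun _ => Measure.pi fun _ => retention q

/-- The probability, for input string `x`, that the function `G` of `T` independent traces
returns `x`. -/
def successProb (q : ℝ) {T n : ℕ} (G : (Fin T → List Bool) → BitString n) (x : BitString n) : ℝ :=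
  (channel q T n).real {ω | G (fun t => trace x (ω t)) = x}

/-- All `n`-bit strings can be reconstructed with probability at least `1 - ε` from `T` traces. -/
def CanReconstruct (q : ℝ) (n T : ℕ) (ε : ℝ) : Prop :=
  ∃ G : (Fin T → List Bool) → BitString n, ∀ x : BitString n, 1 - ε ≤ successProb q G x

/-- The strings `x` and `y` can be distinguished with probability at least `1 - ε` from
`T` traces. -/
def CanDistinguish (q : ℝ) {n : ℕ} (x y : BitString n) (T : ℕ) (ε : ℝ) : Prop :=
  ∃ G : (Fin T → List Bool) → BitString n,
    1 - ε ≤ successProb q G x ∧ 1 - ε ≤ successProb q G y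

/-- The list `(01)^k`. -/
def zeroOne (k : ℕ) : List Bool := (List.replicate k [false, true]).flatten

/-- The list `(01)^a 10 (01)^b`. -/
def defectList (a b : ℕ) : List Bool := zeroOne a ++ [true, false] ++ zeroOne b

/-- The string `(01)^(n-1) 10 (01)^n` of length `4 n`, for `n ≥ 1`. -/
def xString (n : ℕ) : BitString (4 * n) := fun i => (defectList (n - 1) n).getD i false

/-- The string `(01)^n 10 (01)^(n-1)` of length `4 n`, for `n ≥ 1`. -/
def yString (n : ℕ) : BitString (4 * n) := fun i => (defectList n (n - 1)).getD i false

theorem length_defectList (a b : ℕ) : (defectList a b).length = 2 * (a + b + 1) := by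
  simp [defectList, zeroOne]; ring

theorem ofFn_xString {n : ℕ} (hn : 1 ≤ n) : List.ofFn (xString n) = defectList (n - 1) n := by
  have h := length_defectList (n - 1) n
  apply List.ext_getElem
  · simp; omega
  · intro i h1 h2
    simp [xString, List.getElem?_eq_getElem h2]

theorem ofFn_yString {n : ℕ} (hn : 1 ≤ n) : List.ofFn (yString n) = defectList n (n - 1) := by
  have h := length_defectList n (n - 1)
  apply List.ext_getElem
  · simp; omega
  · intro i h1 h2
    simp [yString, List.getElem?_eq_getElem h2]

end TraceReconstruction

end

/-! ### The law of one trace as a linear functional on test functions -/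

namespace TraceReconstruction

/-! The argument yields the larger order `n ^ (3/2) * log (1/ε)`, weakened only at the very end. Let
`L` and `R` average a test function over one nonempty outcome `0`, `1` or `01` of a block `01`,
attached in front or at the end; they commute. The traces of `10` and `01` differ in law only when
both bits survive. Hence the two trace laws differ by a multiple of the swap functional `h ↦ h(10) -
h(01)` composed with `B ^ m * (R - L)`, where `B` attaches the trace of one block on each side
(`traceMean_defectList_sub`).

Expanding `B` leaves terms `(R - L) (L + R)^M (L R)^d`, and two facts make them small. The
coefficients of `(y - x) (x + y)^M` have square sum at most of order `4^M M^(-3/2)`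
(`sum_binomDiff_sq_le`). The signed insertions of a swapped pair of tokens at different places of an
i.i.d. sequence are almost orthogonal, since those at distance at least two are uncorrelated, so
they satisfy a Bessel inequality (`sum_swapDiff_sq_add_le`). Cauchy–Schwarz and averaging over `M`
and `d` then bound the difference of the means of `h` by `K m^(-3/2)` plus half the second moment of
`h` (`exists_mul_swapDiff_le`, `exists_traceClose_defectList`).

Taking `h = (p - r) / (p + r)` for the trace probabilities `p`, `r` makes the Bhattacharyya affinity
at least `1 - K m^(-3/2)` up to the shift in `m`. Affinity is multiplicative over independent
traces, while a test with error `ε` forces its `2T`-th power below `4ε(1 - ε)`; this bounds `T` from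
below (`le_mul_of_canDistinguish`). For reconstruction at a general length, a common suffix is
appended, which preserves closeness. -/

/-- The expectation of `h` evaluated at the trace of the list `X`, as a linear functional of
`h`. -/
noncomputable def traceMean (q : ℝ) : List Bool → (List Bool → ℝ) →ₗ[ℝ] ℝ
  | [] => LinearMap.proj []
  | c :: X => q • traceMean q X + (1 - q) • traceMean q X ∘ₗ LinearMap.funLeft ℝ ℝ (List.cons c)

theorem traceMean_nil (q : ℝ) (h : List Bool → ℝ) : traceMean q [] h = h [] := rfl

theorem traceMean_cons (q : ℝ) (c : Bool) (X : List Bool) (h : List Bool → ℝ) :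
    traceMean q (c :: X) h = q * traceMean q X h + (1 - q) * traceMean q X (fun s => h (c :: s)) :=
  rfl

theorem traceMean_append (q : ℝ) (X U : List Bool) (h : List Bool → ℝ) :
    traceMean q (X ++ U) h = traceMean q X (fun s => traceMean q U (fun u => h (s ++ u))) := by
  induction X generalizing h with
  | nil => simp [traceMean_nil]
  | cons c X ih => simp [traceMean_cons, ih]

theorem traceMean_mono {q : ℝ} (h0 : 0 ≤ q) (h1 : q ≤ 1) (X : List Bool) {h g : List Bool → ℝ}
    (hg : ∀ s, h s ≤ g s) : traceMean q X h ≤ traceMean q X g := by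
  induction X generalizing h g with
  | nil => exact hg []
  | cons c X ih =>
    simp only [traceMean_cons]
    have := sub_nonneg.2 h1
    gcongr
    · exact ih hg
    · exact ih fun s => hg _

theorem traceMean_const (q : ℝ) (X : List Bool) (a : ℝ) : traceMean q X (fun _ => a) = a := by
  induction X with
  | nil => rfl
  | cons c X ih => simp only [traceMean_cons, ih]; ring

theorem traceMean_nonneg {q : ℝ} (h0 : 0 ≤ q) (h1 : q ≤ 1) (X : List Bool) {h : List Bool → ℝ}
    (hh : ∀ s, 0 ≤ h s) : 0 ≤ traceMean q X h := by
  have := traceMean_mono h0 h1 X hh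
  rwa [traceMean_const] at this

theorem abs_traceMean_le_one {q : ℝ} (h0 : 0 ≤ q) (h1 : q ≤ 1) (X : List Bool)
    {h : List Bool → ℝ} (hh : ∀ s, |h s| ≤ 1) : |traceMean q X h| ≤ 1 := by
  have l := traceMean_mono h0 h1 X fun s => neg_le_of_abs_le (hh s)
  have u := traceMean_mono h0 h1 X fun s => le_of_abs_le (hh s)
  rw [traceMean_const] at l u
  exact abs_le.2 ⟨l, u⟩

theorem sq_traceMean_le {q : ℝ} (h0 : 0 ≤ q) (h1 : q ≤ 1) (X : List Bool)
    (h : List Bool → ℝ) : traceMean q X h ^ 2 ≤ traceMean q X (fun s => h s ^ 2) := by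
  set a := traceMean q X h with ha
  have key : 0 ≤ traceMean q X (fun s => (h s - a) ^ 2) :=
    traceMean_nonneg h0 h1 X fun s => sq_nonneg _
  have e : (fun s => (h s - a) ^ 2)
      = (fun s => h s ^ 2) - (2 * a) • h + (fun _ => a ^ 2) := by
    ext s; simp; ring
  rw [e, map_add, map_sub, map_smul, traceMean_const, ← ha, smul_eq_mul] at key
  nlinarith

/-- The probability of the retention pattern `m`. -/
noncomputable def maskWeight (q : ℝ) {n : ℕ} (m : Fin n → Bool) : ℝ :=
  ∏ i, if m i then 1 - q else q

theorem trace_cons {n : ℕ} (x : BitString (n + 1)) (b : Bool) (m : Fin n → Bool) :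
    trace x (Fin.cons b m : Fin (n + 1) → Bool)
      = if b then x 0 :: trace (Fin.tail x) m else trace (Fin.tail x) m := by
  have e : ∀ l : List (Fin n), List.map x (List.filter (fun i => (Fin.cons b m : Fin (n + 1) → Bool) i)
      (List.map Fin.succ l)) = List.map (Fin.tail x) (List.filter (fun i => m i) l) := by
    intro l
    rw [List.filter_map, List.map_map]
    rfl
  cases b <;> simp [trace, List.finRange_succ, e]

theorem sum_maskWeight_mul (q : ℝ) {n : ℕ} (x : BitString n) (h : List Bool → ℝ) :
    ∑ m, maskWeight q m * h (trace x m) = traceMean q (List.ofFn x) h := by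
  induction n generalizing h with
  | zero => simp [maskWeight, trace, traceMean_nil]
  | succ n ih =>
    have e : ∀ b (m : Fin n → Bool), (Fin.consEquiv fun _ => Bool) (b, m)
        = (Fin.cons b m : Fin (n + 1) → Bool) := fun _ _ => rfl
    have e1 := ih (Fin.tail x) h
    have e2 := ih (Fin.tail x) (fun s => h (x 0 :: s))
    rw [← (Fin.consEquiv fun _ => Bool).sum_comp, Fintype.sum_prod_type, List.ofFn_succ,
      traceMean_cons]
    simp only [Fintype.sum_bool, e, trace_cons, maskWeight, Fin.prod_univ_succ, Fin.cons_zero,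
      Fin.cons_succ, if_true, Bool.false_eq_true, if_false, mul_assoc, ← Finset.mul_sum]
    simp only [maskWeight] at e1 e2
    rw [e1, e2, add_comm]
    rfl

theorem channel_real_singleton {q : ℝ} (h0 : 0 ≤ q) (h1 : q ≤ 1) {T n : ℕ}
    (ω : Fin T → Fin n → Bool) : (channel q T n).real {ω} = ∏ t, maskWeight q (ω t) := by
  have := isProbabilityMeasure_retention h0 h1
  have e : ∀ b : Bool, (retention q).real {b} = if b then 1 - q else q := by
    intro b
    have := sub_nonneg.2 h1
    cases b <;> simp [retention, Measure.real, h0, this]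
  simp only [Measure.real, channel, Measure.pi_singleton, ENNReal.toReal_prod, maskWeight]
  simp only [← Measure.real.eq_1, e]

theorem successProb_eq_sum {q : ℝ} (h0 : 0 ≤ q) (h1 : q ≤ 1) {T n : ℕ}
    (G : (Fin T → List Bool) → BitString n) (x : BitString n) :
    successProb q G x = ∑ ω : Fin T → Fin n → Bool,
      (∏ t, maskWeight q (ω t)) * if G (fun t => trace x (ω t)) = x then 1 else 0 := by
  classical
  have := isProbabilityMeasure_retention h0 h1
  have : IsProbabilityMeasure (channel q T n) := by unfold channel; infer_instance
  have e : {ω : Fin T → Fin n → Bool | G (fun t => trace x (ω t)) = x}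
      = ((Finset.univ.filter fun ω : Fin T → Fin n → Bool => G (fun t => trace x (ω t)) = x :
        Finset _) : Set _) := by
    ext ω; simp
  rw [successProb, e, ← sum_measureReal_singleton, Finset.sum_filter]
  refine Finset.sum_congr rfl fun ω _ => ?_
  rw [channel_real_singleton h0 h1]
  split_ifs <;> simp

/-- The probability that the trace of `X` equals `s`. -/
noncomputable def traceProb (q : ℝ) (X s : List Bool) : ℝ :=
  traceMean q X (fun u => if u = s then 1 else 0)

theorem traceProb_nonneg {q : ℝ} (h0 : 0 ≤ q) (h1 : q ≤ 1) (X s : List Bool) :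
    0 ≤ traceProb q X s :=
  traceMean_nonneg h0 h1 X fun u => by split_ifs <;> simp

/-- The possible traces of strings of length `n`. -/
def words (n : ℕ) : Finset (List Bool) :=
  (Finset.univ : Finset (BitString n × (Fin n → Bool))).image fun a => trace a.1 a.2

theorem trace_mem_words {n : ℕ} (x : BitString n) (m : Fin n → Bool) : trace x m ∈ words n :=
  Finset.mem_image.2 ⟨(x, m), Finset.mem_univ _, rfl⟩

theorem traceProb_eq_sum (q : ℝ) {n : ℕ} (x : BitString n) (s : List Bool) :
    traceProb q (List.ofFn x) s = ∑ m, maskWeight q m * if trace x m = s then 1 else 0 := by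
  rw [traceProb, ← sum_maskWeight_mul]

theorem traceMean_eq_sum (q : ℝ) {n : ℕ} (x : BitString n) (h : List Bool → ℝ) :
    traceMean q (List.ofFn x) h = ∑ s ∈ words n, traceProb q (List.ofFn x) s * h s := by
  simp only [traceProb_eq_sum, Finset.sum_mul]
  rw [Finset.sum_comm, ← sum_maskWeight_mul]
  refine Finset.sum_congr rfl fun m _ => ?_
  rw [Finset.sum_eq_single (trace x m)]
  · simp
  · intro s _ hs
    simp [hs.symm]
  · intro hs
    exact absurd (trace_mem_words x m) hs

theorem successProb_eq_sum_words {q : ℝ} (h0 : 0 ≤ q) (h1 : q ≤ 1) {T n : ℕ}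
    (G : (Fin T → List Bool) → BitString n) (x : BitString n) :
    successProb q G x = ∑ s ∈ Fintype.piFinset fun _ : Fin T => words n,
      (∏ t, traceProb q (List.ofFn x) (s t)) * if G s = x then 1 else 0 := by
  classical
  rw [successProb_eq_sum h0 h1]
  simp only [traceProb_eq_sum, Finset.prod_univ_sum, Fintype.piFinset_univ, Finset.sum_mul]
  rw [Finset.sum_comm]
  refine Finset.sum_congr rfl fun ω _ => ?_
  rw [Finset.sum_eq_single fun t => trace x (ω t)]
  · simp
  · intro s _ hs
    obtain ⟨t, ht⟩ := Function.ne_iff.1 hs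
    rw [Finset.prod_eq_zero (Finset.mem_univ t), zero_mul]
    simp [ht.symm]
  · intro hs
    exact absurd (Fintype.mem_piFinset.2 fun t => trace_mem_words x (ω t)) hs

/-! ### Testing error, affinity and closeness of trace laws -/

/-- Two hypotheses that are told apart with error at most `ε` from `T` samples have small
Bhattacharyya affinity. -/
theorem affinity_pow_le {α : Type*} (S : Finset α) (p r : α → ℝ) (hp : ∀ s, 0 ≤ p s)
    (hr : ∀ s, 0 ≤ r s) (hp1 : ∑ s ∈ S, p s = 1) (hr1 : ∑ s ∈ S, r s = 1) (T : ℕ)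
    (A : (Fin T → α) → Prop) [DecidablePred A] {ε : ℝ} (hε : ε ≤ 1 / 2)
    (hA : 1 - ε ≤ ∑ s ∈ (Fintype.piFinset fun _ : Fin T => S) with A s, ∏ t, p (s t))
    (hA' : 1 - ε ≤ ∑ s ∈ (Fintype.piFinset fun _ : Fin T => S) with ¬ A s, ∏ t, r (s t)) :
    (∑ s ∈ S, √(p s) * √(r s)) ^ (2 * T) ≤ 4 * ε * (1 - ε) := by
  have tot : ∀ f : α → ℝ, ∑ s ∈ S, f s = 1 →
      ∑ s ∈ (Fintype.piFinset fun _ : Fin T => S), ∏ t, f (s t) = 1 := by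
    intro f hf
    rw [← Finset.prod_univ_sum]; simp [hf]
  set F := Fintype.piFinset fun _ : Fin T => S with hF
  set P : (Fin T → α) → ℝ := fun s => ∏ t, p (s t) with hP
  set R : (Fin T → α) → ℝ := fun s => ∏ t, r (s t) with hR
  have P0 : ∀ s, 0 ≤ P s := fun s => Finset.prod_nonneg fun t _ => hp _
  have R0 : ∀ s, 0 ≤ R s := fun s => Finset.prod_nonneg fun t _ => hr _
  have hPs := tot p hp1
  have hRs := tot r hr1
  rw [← Finset.sum_filter_add_sum_filter_not F A] at hPs hRs
  set a := ∑ s ∈ F with A s, P s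
  set a' := ∑ s ∈ F with ¬ A s, P s
  set b := ∑ s ∈ F with A s, R s
  set b' := ∑ s ∈ F with ¬ A s, R s
  have ha' : 0 ≤ a' := Finset.sum_nonneg fun s _ => P0 s
  have ha : 0 ≤ a := Finset.sum_nonneg fun s _ => P0 s
  have hb : 0 ≤ b := Finset.sum_nonneg fun s _ => R0 s
  have hb' : 0 ≤ b' := Finset.sum_nonneg fun s _ => R0 s
  have pow : (∑ s ∈ S, √(p s) * √(r s)) ^ T = ∑ s ∈ F, √(P s) * √(R s) := by
    have : (∑ s ∈ S, √(p s) * √(r s)) ^ T = ∏ _t : Fin T, ∑ s ∈ S, √(p s) * √(r s) := by simp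
    rw [this, Finset.prod_univ_sum]
    refine Finset.sum_congr rfl fun s _ => ?_
    rw [Finset.prod_mul_distrib, hP, hR, Real.sqrt_prod _ fun t _ => hp _,
      Real.sqrt_prod _ fun t _ => hr _]
  have cs : ∀ U : Finset (Fin T → α),
      ∑ s ∈ U, √(P s) * √(R s) ≤ √(∑ s ∈ U, P s) * √(∑ s ∈ U, R s) := by
    intro U
    have := Real.sum_mul_le_sqrt_mul_sqrt U (fun s => √(P s)) (fun s => √(R s))
    simpa only [Real.sq_sqrt (P0 _), Real.sq_sqrt (R0 _)] using this
  have le : (∑ s ∈ S, √(p s) * √(r s)) ^ T ≤ √a * √b + √a' * √b' := by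
    rw [pow, ← Finset.sum_filter_add_sum_filter_not F A]
    exact add_le_add (cs _) (cs _)
  have nn : 0 ≤ (∑ s ∈ S, √(p s) * √(r s)) ^ T :=
    pow_nonneg (Finset.sum_nonneg fun s _ => by positivity) _
  rw [mul_comm 2 T, pow_mul]
  -- Lagrange's identity: the second square is at least `(1 - 2ε)²`, which leaves at most `4ε(1 -
  -- ε)` for the first.
  have lag : (√a * √b + √a' * √b') ^ 2 + (√a * √b' - √a' * √b) ^ 2 = 1 := by
    have e1 := Real.sq_sqrt ha
    have e2 := Real.sq_sqrt ha'
    have e3 := Real.sq_sqrt hb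
    have e4 := Real.sq_sqrt hb'
    calc _ = (√a ^ 2 + √a' ^ 2) * (√b ^ 2 + √b' ^ 2) := by ring
      _ = 1 := by rw [e1, e2, e3, e4, hPs, hRs, one_mul]
  have big : 1 - ε ≤ √a * √b' := by
    rw [← Real.sqrt_mul ha]
    apply Real.le_sqrt_of_sq_le
    nlinarith
  have small : √a' * √b ≤ ε := by
    rw [← Real.sqrt_mul ha']
    apply Real.sqrt_le_iff.2
    constructor <;> nlinarith
  have sq1 : ((∑ s ∈ S, √(p s) * √(r s)) ^ T) ^ 2 ≤ (√a * √b + √a' * √b') ^ 2 := by gcongr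
  nlinarith

/-- If `ε ≤ ε₀ < 1/2` then `log (1 / (4 ε (1 - ε)))` is comparable to `log (1 / ε)`. -/
theorem exists_mul_log_le {ε₀ : ℝ} (h0 : 0 < ε₀) (h1 : ε₀ < 1 / 2) :
    ∃ c : ℝ, 0 < c ∧ ∀ ε : ℝ, 0 < ε → ε ≤ ε₀ →
      c * Real.log (1 / ε) ≤ - Real.log (4 * ε * (1 - ε)) := by
  set a := - Real.log (4 * ε₀ * (1 - ε₀)) with ha
  have hε₁ : 0 < 1 - ε₀ := by linarith
  have a0 : 0 < a := by
    rw [ha, neg_pos]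
    exact Real.log_neg (by positivity) (by nlinarith [sq_pos_of_pos (by linarith : 0 < 1 - 2 * ε₀)])
  have l16 : 0 < Real.log 16 := Real.log_pos (by norm_num)
  refine ⟨min (1 / 2) (a / Real.log 16), by positivity, fun ε he hle => ?_⟩
  have hε1 : 0 < 1 - ε := by linarith
  have hlog : 0 < Real.log (1 / ε) := Real.log_pos (by rw [lt_div_iff₀ he]; linarith)
  -- Below `1/16`, `log 4` is at most half of `log (1/ε)`; above it, `log (1/ε)` is bounded and
  -- monotonicity on `(0, 1/2)` suffices.
  rcases le_total ε (1 / 16) with h | h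
  · refine (mul_le_mul_of_nonneg_right (min_le_left _ _) hlog.le).trans ?_
    rw [Real.log_mul (by positivity) hε1.ne', Real.log_mul (by norm_num) he.ne', one_div ε,
      Real.log_inv]
    have e1 : Real.log (1 - ε) ≤ 0 := Real.log_nonpos hε1.le (by linarith)
    have e2 : Real.log ε ≤ Real.log (1 / 16) := Real.log_le_log he h
    have e3 : Real.log (1 / 16) = - (2 * Real.log 4) := by
      rw [one_div, Real.log_inv, show (16 : ℝ) = 4 ^ 2 by norm_num, Real.log_pow]; simp
    linarith
  · refine (mul_le_mul_of_nonneg_right (min_le_right _ _) hlog.le).trans ?_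
    have e1 : Real.log (1 / ε) ≤ Real.log 16 :=
      Real.log_le_log (by positivity) (by rw [div_le_iff₀ he]; linarith)
    have e2 : a ≤ - Real.log (4 * ε * (1 - ε)) := by
      rw [ha, neg_le_neg_iff]
      exact Real.log_le_log (by positivity) (by nlinarith)
    refine le_trans ?_ e2
    rw [div_mul_eq_mul_div, div_le_iff₀ l16]
    gcongr

/-- A one-sided form of the closeness of the trace laws of `X` and `Y`. It bounds their triangular
discrimination. -/
def TraceClose (q κ : ℝ) (X Y : List Bool) : Prop :=
  ∀ h : List Bool → ℝ, (∀ s, |h s| ≤ 1) →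
    traceMean q X h - traceMean q Y h ≤ κ + traceMean q X (fun s => h s ^ 2) / 2

theorem sum_traceProb (q : ℝ) {n : ℕ} (x : BitString n) :
    ∑ s ∈ words n, traceProb q (List.ofFn x) s = 1 := by
  have := traceMean_eq_sum q x (fun _ => 1)
  rw [traceMean_const] at this
  simpa using this.symm

theorem TraceClose.affinity_ge {q κ : ℝ} (h0 : 0 ≤ q) (h1 : q ≤ 1) {n : ℕ} {x y : BitString n}
    (hc : TraceClose q κ (List.ofFn x) (List.ofFn y)) :
    1 - κ ≤ ∑ s ∈ words n, √(traceProb q (List.ofFn x) s) * √(traceProb q (List.ofFn y) s) := by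
  set p := traceProb q (List.ofFn x) with hp
  set r := traceProb q (List.ofFn y) with hr
  have p0 : ∀ s, 0 ≤ p s := traceProb_nonneg h0 h1 _
  have r0 : ∀ s, 0 ≤ r s := traceProb_nonneg h0 h1 _
  have hp1 : ∑ s ∈ words n, p s = 1 := sum_traceProb q x
  have hr1 : ∑ s ∈ words n, r s = 1 := sum_traceProb q y
  -- For this test function the difference of means is the triangular discrimination `Δ = ∑ (p - r)²
  -- / (p + r)`, and the second moment under `p` is at most `Δ`. Closeness gives `Δ ≤ κ + Δ/2`, and
  -- one minus the affinity is at most `Δ/2`.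
  set h : List Bool → ℝ := fun s => (p s - r s) / (p s + r s) with hh
  have key := hc h fun s => by
    rw [hh, abs_div, abs_of_nonneg (add_nonneg (p0 s) (r0 s))]
    refine div_le_one_of_le₀ (abs_le.2 ⟨?_, ?_⟩) (add_nonneg (p0 s) (r0 s)) <;>
      linarith [p0 s, r0 s]
  simp only [traceMean_eq_sum, ← hp, ← hr] at key
  rw [← Finset.sum_sub_distrib] at key
  have pt : ∀ s, (p s + r s) / 2 - √(p s) * √(r s) ≤ (p s * h s - r s * h s) / 2 := by
    intro s
    rcases (add_nonneg (p0 s) (r0 s)).eq_or_lt with e | e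
    · have e1 : p s = 0 := by linarith [p0 s, r0 s]
      have e2 : r s = 0 := by linarith [p0 s, r0 s]
      rw [e1, e2]
      simp
    · have : p s * h s - r s * h s = (p s - r s) ^ 2 / (p s + r s) := by
        rw [hh]; field_simp
      rw [this]
      have e1 := Real.sq_sqrt (p0 s)
      have e2 := Real.sq_sqrt (r0 s)
      have u := Real.sqrt_nonneg (p s)
      have v := Real.sqrt_nonneg (r s)
      have : (p s + r s) - 2 * (√(p s) * √(r s)) ≤ (p s - r s) ^ 2 / (p s + r s) := by
        rw [le_div_iff₀ e]
        generalize √(p s) = a at *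
        generalize √(r s) = b at *
        rw [← e1, ← e2]
        nlinarith [mul_nonneg (mul_nonneg u v) (sq_nonneg (a - b))]
      linarith
  have half : ∑ s ∈ words n, p s * h s ^ 2 ≤ ∑ s ∈ words n, (p s * h s - r s * h s) := by
    refine Finset.sum_le_sum fun s _ => ?_
    rcases (add_nonneg (p0 s) (r0 s)).eq_or_lt with e | e
    · have e1 : p s = 0 := by linarith [p0 s, r0 s]
      have e2 : r s = 0 := by linarith [p0 s, r0 s]
      rw [e1, e2]
      simp
    · have e3 : p s * h s - r s * h s = (p s + r s) * h s ^ 2 := by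
        rw [hh]; field_simp
      rw [e3]
      have := mul_nonneg (r0 s) (sq_nonneg (h s))
      linarith
  have sum := Finset.sum_le_sum fun s (_ : s ∈ words n) => pt s
  rw [Finset.sum_sub_distrib, ← Finset.sum_div, ← Finset.sum_div, Finset.sum_add_distrib, hp1,
    hr1] at sum
  linarith

/-- Keeps the affinity away from zero even where `1 - κ` is negative, so that its logarithm can be
controlled. -/
theorem affinity_ge_of_common_mass {q β : ℝ} (hβ : 0 ≤ β) {n : ℕ}
    {x y : BitString n} (W : List Bool)
    (hx : ∀ h : List Bool → ℝ, (∀ s, 0 ≤ h s) → β * traceMean q W h ≤ traceMean q (List.ofFn x) h)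
    (hy : ∀ h : List Bool → ℝ, (∀ s, 0 ≤ h s) → β * traceMean q W h ≤ traceMean q (List.ofFn y) h)
    (h0 : 0 ≤ q) (h1 : q ≤ 1) :
    β ≤ ∑ s ∈ words n, √(traceProb q (List.ofFn x) s) * √(traceProb q (List.ofFn y) s) := by
  set g : List Bool → ℝ := fun s => √(traceProb q (List.ofFn x) s) * √(traceProb q (List.ofFn y) s)
  set b := traceProb q W
  have b0 : ∀ s, 0 ≤ b s := traceProb_nonneg h0 h1 _
  have le : ∀ s, β * b s ≤ g s := by
    intro s
    have i0 : ∀ u : List Bool, (0 : ℝ) ≤ if u = s then 1 else 0 := fun u => by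
      split_ifs <;> simp
    have e := mul_nonneg hβ (b0 s)
    calc β * b s = √(β * b s) * √(β * b s) := (Real.mul_self_sqrt e).symm
      _ ≤ g s := by
        refine mul_le_mul (Real.sqrt_le_sqrt (hx _ i0)) (Real.sqrt_le_sqrt (hy _ i0))
          (Real.sqrt_nonneg _) (Real.sqrt_nonneg _)
  -- Testing domination on the complement of `words n`, which the trace of `x` never meets, shows
  -- that the trace of `W` lives on `words n` unless `β = 0`.
  have tot : β ≤ β * ∑ s ∈ words n, b s := by
    have hz := hx (fun s => if s ∈ words n then 0 else 1) fun s => by split_ifs <;> simp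
    have zero : traceMean q (List.ofFn x) (fun s => if s ∈ words n then 0 else 1) = 0 := by
      rw [traceMean_eq_sum]
      exact Finset.sum_eq_zero fun s hs => by simp [hs]
    have e : (∑ s ∈ words n, b s) + traceMean q W (fun s => if s ∈ words n then 0 else 1) = 1 := by
      simp only [b, traceProb]
      rw [← map_sum, ← map_add]
      refine (congrArg _ ?_).trans (traceMean_const q W 1)
      ext u
      by_cases hu : u ∈ words n <;> simp [hu, Finset.sum_apply]
    rw [zero] at hz
    nlinarith
  calc β ≤ β * ∑ s ∈ words n, b s := tot
    _ ≤ _ := by rw [Finset.mul_sum]; exact Finset.sum_le_sum fun s _ => le s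

/-- Lower bound on the number of traces needed to tell apart two strings with close trace laws. -/
theorem le_mul_of_canDistinguish {q κ β : ℝ} (h0 : 0 ≤ q) (h1 : q ≤ 1) (hβ : 0 < β)
    {n T : ℕ} {x y : BitString n} (hxy : x ≠ y)
    (hc : TraceClose q κ (List.ofFn x) (List.ofFn y)) (W : List Bool)
    (hx : ∀ h : List Bool → ℝ, (∀ s, 0 ≤ h s) → β * traceMean q W h ≤ traceMean q (List.ofFn x) h)
    (hy : ∀ h : List Bool → ℝ, (∀ s, 0 ≤ h s) → β * traceMean q W h ≤ traceMean q (List.ofFn y) h)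
    {ε : ℝ} (hε : ε ≤ 1 / 2) (hT : CanDistinguish q x y T ε) :
    - Real.log (4 * ε * (1 - ε)) ≤ 2 * T * (κ / β) := by
  classical
  obtain ⟨G, hGx, hGy⟩ := hT
  rw [successProb_eq_sum_words h0 h1] at hGx hGy
  have p0 : ∀ s, 0 ≤ traceProb q (List.ofFn x) s := traceProb_nonneg h0 h1 _
  have r0 : ∀ s, 0 ≤ traceProb q (List.ofFn y) s := traceProb_nonneg h0 h1 _
  have aff := affinity_pow_le (words n) _ _ p0 r0 (sum_traceProb q x) (sum_traceProb q y) T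
    (fun s => G s = x) hε
    (by simpa [Finset.sum_filter] using hGx)
    (by
      refine hGy.trans ?_
      rw [Finset.sum_filter]
      refine Finset.sum_le_sum fun s _ => ?_
      have := Finset.prod_nonneg fun t (_ : t ∈ Finset.univ) => r0 (s t)
      by_cases e : G s = y
      · simp [e, hxy.symm]
      · simp only [e, if_false, mul_zero]
        split_ifs <;> simp [this])
  have lo := hc.affinity_ge h0 h1
  have lb := affinity_ge_of_common_mass hβ.le W hx hy h0 h1
  set ρ := ∑ s ∈ words n, √(traceProb q (List.ofFn x) s) * √(traceProb q (List.ofFn y) s)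
  have ρ0 : 0 < ρ := hβ.trans_le lb
  have l1 : Real.log (ρ ^ (2 * T)) ≤ Real.log (4 * ε * (1 - ε)) :=
    Real.log_le_log (by positivity) aff
  rw [Real.log_pow] at l1
  have l2 := Real.one_sub_inv_le_log_of_pos ρ0
  have ρ1 : ρ ≤ 1 := by
    have := Real.sum_mul_le_sqrt_mul_sqrt (words n) (fun s => √(traceProb q (List.ofFn x) s))
      (fun s => √(traceProb q (List.ofFn y) s))
    simpa only [Real.sq_sqrt (p0 _), Real.sq_sqrt (r0 _), sum_traceProb, Real.sqrt_one,
      one_mul] using this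
  -- The numerator of `(1 - ρ) / ρ` is bounded by closeness, the denominator by the common mass.
  have l3 : ρ⁻¹ - 1 ≤ κ / β := by
    have : ρ⁻¹ - 1 = (1 - ρ) / ρ := by field_simp
    rw [this]
    exact div_le_div₀ (by linarith) (by linarith) hβ lb
  have l4 : - Real.log ρ ≤ κ / β := by linarith
  have : (0 : ℝ) ≤ 2 * T := by positivity
  push_cast at l1
  nlinarith

/-- Appending a common suffix does not make trace laws easier to tell apart. -/
theorem TraceClose.append {q κ : ℝ} (h0 : 0 ≤ q) (h1 : q ≤ 1) {X Y : List Bool}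
    (hc : TraceClose q κ X Y) (U : List Bool) : TraceClose q κ (X ++ U) (Y ++ U) := by
  intro h hh
  rw [traceMean_append, traceMean_append, traceMean_append]
  -- Closeness is applied to the mean of `h` over the trace of the suffix; Jensen's inequality
  -- controls its square.
  refine (hc _ fun s => abs_traceMean_le_one h0 h1 U fun u => hh _).trans ?_
  gcongr
  exact traceMean_mono h0 h1 X fun s => sq_traceMean_le h0 h1 U _

theorem traceClose_two {q : ℝ} (h0 : 0 ≤ q) (h1 : q ≤ 1) (X Y : List Bool) :
    TraceClose q 2 X Y := by
  intro h hh
  have e1 := le_of_abs_le (abs_traceMean_le_one h0 h1 X hh)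
  have e2 := neg_le_of_abs_le (abs_traceMean_le_one h0 h1 Y hh)
  have e3 := traceMean_nonneg h0 h1 X fun s => sq_nonneg (h s)
  linarith

/-! ### Random tokens attached on either side, and the Bessel inequality -/

/-- The operator taking `h` to `s ↦ h (t ++ s)`. -/
def leftShift (t : List Bool) : Module.End ℝ (List Bool → ℝ) :=
  LinearMap.funLeft ℝ ℝ fun s => t ++ s

/-- The operator taking `h` to `s ↦ h (s ++ t)`. -/
def rightShift (t : List Bool) : Module.End ℝ (List Bool → ℝ) :=
  LinearMap.funLeft ℝ ℝ fun s => s ++ t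

theorem leftShift_apply (t s : List Bool) (h : List Bool → ℝ) : leftShift t h s = h (t ++ s) := rfl

theorem rightShift_apply (t s : List Bool) (h : List Bool → ℝ) :
    rightShift t h s = h (s ++ t) := rfl

section Tokens

variable {ι : Type*} [Fintype ι] (μ : ι → ℝ) (tok : ι → List Bool)

/-- Averaging over a random token added in front. -/
noncomputable def leftAvg : Module.End ℝ (List Bool → ℝ) := ∑ i, μ i • leftShift (tok i)

/-- Averaging over a random token added at the end. -/
noncomputable def rightAvg : Module.End ℝ (List Bool → ℝ) := ∑ i, μ i • rightShift (tok i)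

theorem leftAvg_apply (h : List Bool → ℝ) (s : List Bool) :
    leftAvg μ tok h s = ∑ i, μ i * h (tok i ++ s) := by
  simp [leftAvg, Finset.sum_apply, leftShift_apply]

theorem rightAvg_apply (h : List Bool → ℝ) (s : List Bool) :
    rightAvg μ tok h s = ∑ i, μ i * h (s ++ tok i) := by
  simp [rightAvg, Finset.sum_apply, rightShift_apply]

theorem commute_leftShift_rightShift (t u : List Bool) :
    Commute (leftShift t) (rightShift u) := by
  ext h s
  simp [leftShift_apply, rightShift_apply]

theorem commute_leftShift_rightAvg (t : List Bool) :
    Commute (leftShift t) (rightAvg μ tok) :=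
  Commute.sum_right _ _ _ fun _ _ => (commute_leftShift_rightShift _ _).smul_right _

theorem commute_leftAvg_rightAvg : Commute (leftAvg μ tok) (rightAvg μ tok) :=
  Commute.sum_left _ _ _ fun _ _ => (commute_leftShift_rightAvg μ tok _).smul_left _

theorem rightAvg_apply_nil (h : List Bool → ℝ) : rightAvg μ tok h [] = leftAvg μ tok h [] := by
  simp [leftAvg_apply, rightAvg_apply]

/-- The mean of `h` at the concatenation of `N` independent random tokens. -/
noncomputable def iidMean (N : ℕ) (h : List Bool → ℝ) : ℝ := (leftAvg μ tok ^ N) h []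

theorem iidMean_succ (N : ℕ) (h : List Bool → ℝ) :
    iidMean μ tok (N + 1) h = ∑ i, μ i * iidMean μ tok N (leftShift (tok i) h) := by
  simp [iidMean, pow_succ, leftAvg, Finset.sum_apply]

/-- On the empty word the two sides are indistinguishable, so right averages can be turned into left
ones one at a time. -/
theorem leftAvg_pow_rightAvg_pow_nil (k l : ℕ) (h : List Bool → ℝ) :
    (leftAvg μ tok ^ k * rightAvg μ tok ^ l) h [] = iidMean μ tok (k + l) h := by
  induction l generalizing k with
  | zero => simp [iidMean]
  | succ l ih =>
    have hc := commute_leftAvg_rightAvg μ tok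
    rw [pow_succ', ← mul_assoc, (hc.pow_left k).eq, mul_assoc, Module.End.mul_apply,
      rightAvg_apply_nil, ← Module.End.mul_apply, ← mul_assoc, ← pow_succ', ih]
    congr 1
    ring

variable {μ}

theorem iidMean_nonneg (hμ : ∀ i, 0 ≤ μ i) (N : ℕ) {h : List Bool → ℝ} (hh : ∀ s, 0 ≤ h s) :
    0 ≤ iidMean μ tok N h := by
  induction N generalizing h with
  | zero => simpa [iidMean] using hh []
  | succ N ih =>
    rw [iidMean_succ]
    exact Finset.sum_nonneg fun i _ => mul_nonneg (hμ i) (ih fun s => hh _)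

theorem iidMean_le_one (hμ : ∀ i, 0 ≤ μ i) (h1 : ∑ i, μ i = 1) (N : ℕ) {h : List Bool → ℝ}
    (hh : ∀ s, h s ≤ 1) : iidMean μ tok N h ≤ 1 := by
  induction N generalizing h with
  | zero => simpa [iidMean] using hh []
  | succ N ih =>
    rw [iidMean_succ, ← h1]
    exact Finset.sum_le_sum fun i _ => mul_le_of_le_one_right (hμ i) (ih fun s => hh _)

/-- Jensen's inequality for squares, for a finite average. -/
theorem sq_sum_mul_le {κ : Type*} [Fintype κ] {ν : κ → ℝ} (hν : ∀ i, 0 ≤ ν i) (h1 : ∑ i, ν i = 1)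
    (g : κ → ℝ) : (∑ i, ν i * g i) ^ 2 ≤ ∑ i, ν i * g i ^ 2 := by
  have := Finset.sum_sq_le_sum_mul_sum_of_sq_le_mul Finset.univ (r := fun i => ν i * g i)
    (fun i _ => hν i) (fun i _ => mul_nonneg (hν i) (sq_nonneg (g i))) fun i _ => le_of_eq (by ring)
  rwa [h1, one_mul] at this

/-- The variance of a finite distribution with two atoms of equal mass is at least half that mass
times the squared difference of the values there. -/
theorem mul_sq_sub_le_variance {κ : Type*} [Fintype κ] [DecidableEq κ] {ν : κ → ℝ}
    (hν : ∀ i, 0 ≤ ν i) (h1 : ∑ i, ν i = 1) (g : κ → ℝ) {u v : κ} (huv : u ≠ v)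
    (he : ν u = ν v) :
    ν u * (g u - g v) ^ 2 ≤ 2 * (∑ i, ν i * g i ^ 2 - (∑ i, ν i * g i) ^ 2) := by
  set m := ∑ i, ν i * g i with hm
  have e : ∑ i, ν i * g i ^ 2 - m ^ 2 = ∑ i, ν i * (g i - m) ^ 2 := by
    have : ∀ i, ν i * (g i - m) ^ 2 = ν i * g i ^ 2 - 2 * m * (ν i * g i) + m ^ 2 * ν i :=
      fun i => by ring
    simp only [this]
    rw [Finset.sum_add_distrib, Finset.sum_sub_distrib, ← Finset.mul_sum, ← Finset.mul_sum, h1,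
      ← hm]
    ring
  have sub : ∑ i ∈ {u, v}, ν i * (g i - m) ^ 2 ≤ ∑ i, ν i * (g i - m) ^ 2 :=
    Finset.sum_le_sum_of_subset_of_nonneg (Finset.subset_univ _)
      fun i _ _ => mul_nonneg (hν i) (sq_nonneg _)
  rw [Finset.sum_pair huv, ← he] at sub
  rw [e]
  nlinarith [mul_nonneg (hν u) (sq_nonneg ((g u - m) + (g v - m)))]

/-- The antisymmetric functional `h ↦ h (ba) - h (ab)` for two tokens `a` and `b`. -/
def swapDiff (s t : List Bool) : (List Bool → ℝ) →ₗ[ℝ] ℝ :=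
  (LinearMap.proj (t ++ s) : (List Bool → ℝ) →ₗ[ℝ] ℝ) - LinearMap.proj (s ++ t)

theorem swapDiff_apply (s t : List Bool) (h : List Bool → ℝ) :
    swapDiff s t h = h (t ++ s) - h (s ++ t) := rfl

theorem iidMean_eq_rightAvg (N : ℕ) (h : List Bool → ℝ) :
    iidMean μ tok N h = (rightAvg μ tok ^ N) h [] := by
  have := leftAvg_pow_rightAvg_pow_nil μ tok 0 N h
  simpa using this.symm

/-- A Bessel inequality for the signed insertions of a swapped pair of tokens at the different
positions of an i.i.d. sequence of tokens. -/
theorem sum_swapDiff_sq_add_le (hμ : ∀ i, 0 ≤ μ i) (h1 : ∑ i, μ i = 1) {a b : ι} (hab : a ≠ b)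
    (n : ℕ) (h : List Bool → ℝ) :
    μ a * μ b * ∑ k ∈ Finset.range n,
        swapDiff (tok a) (tok b) ((leftAvg μ tok ^ k * rightAvg μ tok ^ (n - 1 - k)) h) ^ 2
      + 2 * (∑ i, μ i * iidMean μ tok n (leftShift (tok i) h) ^ 2 - iidMean μ tok (n + 1) h ^ 2)
      ≤ 4 * (iidMean μ tok (n + 1) (h ^ 2) - iidMean μ tok (n + 1) h ^ 2) := by
  classical
  -- Condition on the first token. The variance term on the left, of the conditional mean given that
  -- token, is what closes the induction: the new `k = 0` term costs at most twice the variance of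
  -- the mean given two tokens. By total variance this splits into a part absorbed by the induction
  -- hypothesis and a part paid for by the first token.
  induction n generalizing h with
  | zero =>
    have e : iidMean μ tok 1 (h ^ 2) = ∑ i, μ i * iidMean μ tok 0 (leftShift (tok i) h) ^ 2 := by
      rw [iidMean_succ]; simp [iidMean, leftShift_apply]
    have j := sq_sum_mul_le hμ h1 fun i => iidMean μ tok 0 (leftShift (tok i) h)
    rw [← iidMean_succ] at j
    simp only [Finset.range_zero, Finset.sum_empty, mul_zero, zero_add] at e ⊢
    rw [e]
    linarith
  | succ n ih =>
    have hw : 0 ≤ μ a * μ b := mul_nonneg (hμ a) (hμ b)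
    set G : ι → ι → ℝ := fun i j => iidMean μ tok n (leftShift (tok j) (leftShift (tok i) h))
      with hG
    have Gi : ∀ i, ∑ j, μ j * G i j = iidMean μ tok (n + 1) (leftShift (tok i) h) := fun i =>
      (iidMean_succ μ tok n _).symm
    have G2 : ∀ i, iidMean μ tok (n + 1) (leftShift (tok i) (h ^ 2))
        = iidMean μ tok (n + 1) (leftShift (tok i) h ^ 2) := fun i => rfl
    have zero : swapDiff (tok a) (tok b) ((leftAvg μ tok ^ 0 * rightAvg μ tok ^ (n + 1 - 1 - 0)) h)
        = G b a - G a b := by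
      have aux : ∀ i j, G i j = (rightAvg μ tok ^ n) h (tok i ++ tok j) := by
        intro i j
        have c1 := ((commute_leftShift_rightAvg μ tok (tok i)).pow_right n).eq
        have c2 := ((commute_leftShift_rightAvg μ tok (tok j)).pow_right n).eq
        rw [hG]
        simp only [iidMean_eq_rightAvg]
        rw [← Module.End.mul_apply, ← c2, Module.End.mul_apply, ← Module.End.mul_apply _ _ h, ← c1,
          Module.End.mul_apply, leftShift_apply, leftShift_apply, List.append_nil]
      simp [swapDiff_apply, aux]
    have shift : ∀ k, swapDiff (tok a) (tok b)
          ((leftAvg μ tok ^ (k + 1) * rightAvg μ tok ^ (n + 1 - 1 - (k + 1))) h)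
        = ∑ i, μ i * swapDiff (tok a) (tok b)
          ((leftAvg μ tok ^ k * rightAvg μ tok ^ (n - 1 - k)) (leftShift (tok i) h)) := by
      intro k
      have e : n + 1 - 1 - (k + 1) = n - 1 - k := by omega
      rw [e, pow_succ, mul_assoc, ((commute_leftAvg_rightAvg μ tok).pow_right _).eq, ← mul_assoc,
        Module.End.mul_apply]
      simp only [leftAvg, LinearMap.sum_apply, LinearMap.smul_apply, map_sum, map_smul,
        smul_eq_mul]
    -- The pairs `(b, a)` and `(a, b)` are two atoms of equal mass in the law of the first two
    -- tokens.
    have first := mul_sq_sub_le_variance (κ := ι × ι) (ν := fun x => μ x.1 * μ x.2)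
      (fun x => mul_nonneg (hμ _) (hμ _))
      (by rw [Fintype.sum_prod_type]; simp [← Finset.mul_sum, h1])
      (fun x => G x.1 x.2) (u := (b, a)) (v := (a, b)) (by simp [hab]) (mul_comm _ _)
    simp only [Fintype.sum_prod_type, mul_assoc, ← Finset.mul_sum, Gi] at first
    have rest : μ a * μ b * ∑ k ∈ Finset.range n, (∑ i, μ i * swapDiff (tok a) (tok b)
          ((leftAvg μ tok ^ k * rightAvg μ tok ^ (n - 1 - k)) (leftShift (tok i) h))) ^ 2
        ≤ ∑ i, μ i * (μ a * μ b * ∑ k ∈ Finset.range n, swapDiff (tok a) (tok b)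
          ((leftAvg μ tok ^ k * rightAvg μ tok ^ (n - 1 - k)) (leftShift (tok i) h)) ^ 2) := by
      calc
        _ ≤ μ a * μ b * ∑ k ∈ Finset.range n, ∑ i, μ i * swapDiff (tok a) (tok b)
            ((leftAvg μ tok ^ k * rightAvg μ tok ^ (n - 1 - k)) (leftShift (tok i) h)) ^ 2 := by
            gcongr with k _
            exact sq_sum_mul_le hμ h1 _
        _ = _ := by
            rw [Finset.sum_comm, Finset.mul_sum]
            refine Finset.sum_congr rfl fun i _ => ?_
            rw [← Finset.mul_sum]; ring
    have step := Finset.sum_le_sum fun i (_ : i ∈ Finset.univ) =>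
      mul_le_mul_of_nonneg_left (ih (leftShift (tok i) h)) (hμ i)
    rw [Finset.sum_range_succ']
    simp only [zero, shift]
    rw [iidMean_succ μ tok (n + 1) (h ^ 2), iidMean_succ μ tok (n + 1) h]
    simp only [G2, mul_add, mul_sub, Finset.sum_add_distrib, Finset.sum_sub_distrib] at step ⊢
    have e4 : ∀ f : ι → ℝ, ∀ c : ℝ, ∑ i, μ i * (c * f i) = c * ∑ i, μ i * f i := by
      intro f c
      rw [Finset.mul_sum]
      exact Finset.sum_congr rfl fun i _ => by ring
    simp only [e4] at step rest
    simp only [hG] at first step ⊢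
    linarith

end Tokens

/-! ### Binomial sums and the decay rate `x ^ (-3/2)` -/

section Scalars

theorem sum_range_choose_mul_choose_succ (M : ℕ) :
    ∑ k ∈ Finset.range (M + 1), M.choose k * M.choose (k + 1) = (2 * M).choose (M + 1) := by
  rw [two_mul, Nat.add_choose_eq, Finset.Nat.sum_antidiagonal_eq_sum_range_succ_mk,
    Finset.sum_range_succ' (fun k => M.choose k * M.choose (M + 1 - k))]
  simp only [Nat.sub_zero, Nat.choose_succ_self, mul_zero, add_zero]
  refine Finset.sum_congr rfl fun k hk => ?_
  have hk' : k ≤ M := Nat.lt_succ_iff.1 (Finset.mem_range.1 hk)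
  rw [Nat.add_sub_add_right, Nat.choose_symm hk', mul_comm]

/-- The coefficient of `x ^ k * y ^ (M + 1 - k)` in `(y - x) * (x + y) ^ M`. -/
def binomDiff (M : ℕ) : ℕ → ℝ
  | 0 => 1
  | k + 1 => M.choose (k + 1) - M.choose k

/-- Expanding the square leaves sums of squares and of neighbouring products of binomial
coefficients, both evaluated by Vandermonde. Their near cancellation gains the factor `1 / (M + 1)`.
-/
theorem sum_binomDiff_sq (M : ℕ) :
    (M + 1) * ∑ k ∈ Finset.range (M + 2), binomDiff M k ^ 2 = 2 * Nat.centralBinom M := by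
  have e1 : (∑ k ∈ Finset.range (M + 1), (M.choose k : ℝ) ^ 2) = Nat.centralBinom M := by
    rw [Nat.centralBinom_eq_two_mul_choose, ← Nat.sum_range_choose_sq]
    push_cast
    rfl
  have e2 : (∑ k ∈ Finset.range (M + 1), (M.choose k : ℝ) * M.choose (k + 1))
      = (2 * M).choose (M + 1) := by
    rw [← sum_range_choose_mul_choose_succ]
    push_cast
    rfl
  have e3 : (∑ k ∈ Finset.range (M + 1), (M.choose (k + 1) : ℝ) ^ 2) + 1
      = Nat.centralBinom M := by
    rw [← e1, Finset.sum_range_succ' (fun k => (M.choose k : ℝ) ^ 2), Finset.sum_range_succ]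
    simp
  have e4 : ((2 * M).choose (M + 1) : ℝ) * (M + 1) = Nat.centralBinom M * M := by
    rw [Nat.centralBinom_eq_two_mul_choose]
    have := Nat.choose_succ_right_eq (2 * M) M
    rw [show 2 * M - M = M by omega] at this
    exact_mod_cast this
  rw [Finset.sum_range_succ']
  simp only [binomDiff, sub_sq, one_pow]
  rw [Finset.sum_add_distrib, Finset.sum_sub_distrib, e1]
  have e5 : (∑ k ∈ Finset.range (M + 1), 2 * (M.choose (k + 1) : ℝ) * M.choose k)
      = 2 * (2 * M).choose (M + 1) := by
    rw [← e2, Finset.mul_sum]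
    exact Finset.sum_congr rfl fun k _ => by ring
  rw [e5]
  linear_combination (M + 1 : ℝ) * e3 - 2 * e4

theorem centralBinom_sq_mul_le (M : ℕ) :
    (Nat.centralBinom M : ℝ) ^ 2 * (2 * M + 1) ≤ (4 ^ M) ^ 2 := by
  induction M with
  | zero => simp
  | succ M ih =>
    have h : ((M + 1 : ℕ) : ℝ) * Nat.centralBinom (M + 1) = 2 * (2 * M + 1) * Nat.centralBinom M :=
      by exact_mod_cast Nat.succ_mul_centralBinom_succ M
    push_cast at h ⊢
    have pos : (0 : ℝ) < (M + 1) ^ 2 := by positivity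
    refine le_of_mul_le_mul_left ?_ pos
    calc ((M : ℝ) + 1) ^ 2 * ((Nat.centralBinom (M + 1) : ℝ) ^ 2 * (2 * (M + 1) + 1))
        = (((M : ℝ) + 1) * Nat.centralBinom (M + 1)) ^ 2 * (2 * M + 3) := by ring
      _ = ((Nat.centralBinom M : ℝ) ^ 2 * (2 * M + 1)) * (4 * (2 * M + 1) * (2 * M + 3)) := by
        rw [h]; ring
      _ ≤ (4 ^ M) ^ 2 * (16 * (M + 1) ^ 2) := by
        refine mul_le_mul ih ?_ (by positivity) (by positivity)
        nlinarith
      _ = ((M : ℝ) + 1) ^ 2 * (4 ^ (M + 1)) ^ 2 := by ring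

/-- The function `x ↦ x ^ (-3/2)` at `x = M + 1`. -/
noncomputable def invThreeHalves (M : ℕ) : ℝ := 1 / ((M + 1) * √(M + 1))

theorem invThreeHalves_nonneg (M : ℕ) : 0 ≤ invThreeHalves M := by
  unfold invThreeHalves; positivity

theorem invThreeHalves_le_one (M : ℕ) : invThreeHalves M ≤ 1 := by
  have h1 : (1 : ℝ) ≤ M + 1 := by linarith [(Nat.cast_nonneg M : (0 : ℝ) ≤ M)]
  have h2 : 1 ≤ √((M : ℝ) + 1) := Real.one_le_sqrt.2 h1
  exact div_le_one_of_le₀ (one_le_mul_of_one_le_of_one_le h1 h2) (by positivity)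

theorem sum_binomDiff_sq_le (M : ℕ) :
    ∑ k ∈ Finset.range (M + 2), binomDiff M k ^ 2 ≤ 2 * 4 ^ M * invThreeHalves M := by
  have e := sum_binomDiff_sq M
  have hM : (0 : ℝ) < M + 1 := by positivity
  have b : (Nat.centralBinom M : ℝ) * √(M + 1) ≤ 4 ^ M := by
    refine le_of_sq_le_sq ?_ (by positivity)
    rw [mul_pow, Real.sq_sqrt hM.le]
    refine le_trans ?_ (centralBinom_sq_mul_le M)
    gcongr
    linarith [(Nat.cast_nonneg M : (0 : ℝ) ≤ M)]
  have hs : 0 < √((M : ℝ) + 1) := Real.sqrt_pos.2 hM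
  rw [invThreeHalves, mul_one_div, le_div_iff₀ (by positivity)]
  calc _ = ((M + 1) * ∑ k ∈ Finset.range (M + 2), binomDiff M k ^ 2) * √((M : ℝ) + 1) := by ring
    _ = 2 * (Nat.centralBinom M * √((M : ℝ) + 1)) := by rw [e]; ring
    _ ≤ _ := by linarith

/-- A converse to log-concavity: the ratio is `(i + 2)(e + 2) / ((i + 1)(e + 1))` with `i = j - e -
2`, hence at most four. -/
theorem choose_sq_le {j e : ℕ} (h : e + 1 < j) :
    (j.choose (e + 1) : ℝ) ^ 2 ≤ 4 * (j.choose e * j.choose (e + 2)) := by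
  obtain ⟨i, rfl⟩ := Nat.exists_eq_add_of_lt h
  have h1 := Nat.choose_succ_right_eq (e + 1 + i + 1) e
  have h2 := Nat.choose_succ_right_eq (e + 1 + i + 1) (e + 1)
  rw [show e + 1 + i + 1 - e = i + 2 by omega] at h1
  rw [show e + 1 + i + 1 - (e + 1) = i + 1 by omega] at h2
  generalize e + 1 + i + 1 = j at *
  have g1 : (j.choose (e + 1) : ℝ) * (e + 1) = j.choose e * (i + 2) := by exact_mod_cast h1
  have g2 : (j.choose (e + 2) : ℝ) * (e + 2) = j.choose (e + 1) * (i + 1) := by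
    have : ((e + 1 + 1 : ℕ) : ℝ) = e + 2 := by push_cast; ring
    rw [← this]; exact_mod_cast h2
  have pos : (0 : ℝ) < (i + 1) * (e + 1) := by positivity
  refine le_of_mul_le_mul_right ?_ pos
  calc (j.choose (e + 1) : ℝ) ^ 2 * ((i + 1) * (e + 1))
      = (j.choose (e + 1) * (e + 1)) * (j.choose (e + 1) * (i + 1)) := by ring
    _ = j.choose e * j.choose (e + 2) * ((i + 2) * (e + 2)) := by rw [g1, ← g2]; ring
    _ ≤ j.choose e * j.choose (e + 2) * (4 * ((i + 1) * (e + 1))) := by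
      refine mul_le_mul_of_nonneg_left ?_ (by positivity)
      nlinarith [(Nat.cast_nonneg i : (0 : ℝ) ≤ i), (Nat.cast_nonneg e : (0 : ℝ) ≤ e),
        mul_nonneg (Nat.cast_nonneg i : (0 : ℝ) ≤ i) (Nat.cast_nonneg e : (0 : ℝ) ≤ e)]
    _ = _ := by ring

/-- A term of the binomial expansion of `(t + w) ^ j`. -/
def binomTerm (t w : ℝ) (j d : ℕ) : ℝ := j.choose d * t ^ d * w ^ (j - d)

theorem binomTerm_nonneg {t w : ℝ} (ht : 0 ≤ t) (hw : 0 ≤ w) (j d : ℕ) :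
    0 ≤ binomTerm t w j d := by unfold binomTerm; positivity

theorem sum_binomTerm (t w : ℝ) (j : ℕ) :
    ∑ d ∈ Finset.range (j + 1), binomTerm t w j d = (t + w) ^ j := by
  rw [add_pow]
  exact Finset.sum_congr rfl fun d _ => by unfold binomTerm; ring

/-- In the main estimate a term with index `d` is controlled by a second moment with index `d + 1`.
This lets Cauchy–Schwarz move the weight accordingly: `U` is essentially the previous binomial term,
with a separate choice at `d = 0`, so its total mass stays comparable. -/
theorem exists_binomTerm_shift {t w : ℝ} (ht : 0 < t) (hw : 0 < w) (j : ℕ) :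
    ∃ U : ℕ → ℝ, (∀ d, 0 ≤ U d) ∧
      (∀ d < j, binomTerm t w j d ^ 2 ≤ U d * binomTerm t w j (d + 1)) ∧
      ∑ d ∈ Finset.range j, U d ≤ (w / t + 4) * (t + w) ^ j := by
  have b0 := binomTerm_nonneg ht.le hw.le j
  refine ⟨fun d => match d with
    | 0 => w / t * binomTerm t w j 0
    | e + 1 => 4 * binomTerm t w j e, ?_, ?_, ?_⟩
  · rintro (_ | e)
    · exact mul_nonneg (by positivity) (b0 0)
    · exact mul_nonneg (by norm_num) (b0 e)
  · rintro (_ | e) hd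
    · obtain ⟨i, rfl⟩ := Nat.exists_eq_add_of_lt hd
      simp only [binomTerm, zero_add, Nat.choose_zero_right, pow_zero, Nat.choose_one_right,
        pow_one, Nat.sub_zero, Nat.add_sub_cancel]
      have : w / t * (((1 : ℕ) : ℝ) * 1 * w ^ (i + 1)) * (((i + 1 : ℕ) : ℝ) * t * w ^ i)
          = (i + 1) * (w ^ (i + 1)) ^ 2 := by
        push_cast
        field_simp
        ring
      rw [this]
      push_cast
      have := mul_nonneg (Nat.cast_nonneg i : (0 : ℝ) ≤ i) (sq_nonneg (w ^ (i + 1)))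
      linarith
    · have c := choose_sq_le hd
      obtain ⟨i, rfl⟩ := Nat.exists_eq_add_of_lt hd
      simp only [binomTerm]
      rw [show e + 1 + i + 1 - (e + 1) = i + 1 by omega, show e + 1 + i + 1 - e = i + 2 by omega,
        show e + 1 + i + 1 - (e + 1 + 1) = i by omega]
      generalize e + 1 + i + 1 = j at *
      have pos : 0 ≤ t ^ (2 * e + 2) * w ^ (2 * i + 2) := by positivity
      have := mul_le_mul_of_nonneg_right c pos
      calc _ = (j.choose (e + 1) : ℝ) ^ 2 * (t ^ (2 * e + 2) * w ^ (2 * i + 2)) := by ring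
        _ ≤ _ := this
        _ = _ := by ring
  · rcases j with _ | j
    · simp; positivity
    · rw [Finset.sum_range_succ']
      simp only
      rw [← Finset.mul_sum]
      have tot := sum_binomTerm t w (j + 1)
      have le1 : ∑ d ∈ Finset.range j, binomTerm t w (j + 1) d ≤ (t + w) ^ (j + 1) := by
        rw [← tot]
        exact Finset.sum_le_sum_of_subset_of_nonneg
          (Finset.range_subset_range.2 (by omega)) fun d _ _ => b0 d
      have le2 : binomTerm t w (j + 1) 0 ≤ (t + w) ^ (j + 1) := by
        rw [← tot]
        exact Finset.single_le_sum (fun d _ => b0 d) (Finset.mem_range.2 (by omega))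
      have : 0 < w / t := by positivity
      nlinarith

/-- Dividing by `M + 1` turns each term into one of the expansion with exponent `m + 1`, whose total
is one. -/
theorem sum_binomTerm_div_le {s : ℝ} (hs : 0 < s) (h1 : s ≤ 1) (m : ℕ) :
    ∑ M ∈ Finset.range (m + 1), binomTerm s (1 - s) m M * (1 / (M + 1)) ≤ 1 / (s * (m + 1)) := by
  have h1' := sub_nonneg.2 h1
  have tot := sum_binomTerm s (1 - s) (m + 1)
  rw [add_sub_cancel, one_pow, Finset.sum_range_succ'] at tot
  rw [le_div_iff₀ (by positivity), Finset.sum_mul]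
  have e : ∀ M ∈ Finset.range (m + 1), binomTerm s (1 - s) m M * (1 / (M + 1)) * (s * (m + 1))
      = binomTerm s (1 - s) (m + 1) (M + 1) := by
    intro M _
    have c : ((m : ℝ) + 1) * m.choose M = (m + 1).choose (M + 1) * (M + 1) := by
      exact_mod_cast Nat.add_one_mul_choose_eq m M
    simp only [binomTerm, Nat.add_sub_add_right]
    field_simp
    linear_combination s ^ M * s * (1 - s) ^ (m - M) * c
  rw [Finset.sum_congr rfl e]
  linarith [binomTerm_nonneg hs.le h1' (m + 1) 0]

theorem sum_binomTerm_div_div_le {s : ℝ} (hs : 0 < s) (h1 : s ≤ 1) (m : ℕ) :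
    ∑ M ∈ Finset.range (m + 1), binomTerm s (1 - s) m M * (1 / ((M + 1) * (M + 2)))
      ≤ 1 / (s ^ 2 * ((m + 1) * (m + 2))) := by
  have h1' := sub_nonneg.2 h1
  have tot := sum_binomTerm s (1 - s) (m + 2)
  rw [add_sub_cancel, one_pow, Finset.sum_range_succ', Finset.sum_range_succ'] at tot
  rw [le_div_iff₀ (by positivity), Finset.sum_mul]
  have e : ∀ M ∈ Finset.range (m + 1),
      binomTerm s (1 - s) m M * (1 / ((M + 1) * (M + 2))) * (s ^ 2 * ((m + 1) * (m + 2)))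
      = binomTerm s (1 - s) (m + 2) (M + 1 + 1) := by
    intro M _
    have c : ((m : ℝ) + 1) * m.choose M = (m + 1).choose (M + 1) * (M + 1) := by
      exact_mod_cast Nat.add_one_mul_choose_eq m M
    have c' : ((m : ℝ) + 2) * (m + 1).choose (M + 1) = (m + 2).choose (M + 2) * (M + 2) := by
      have := Nat.add_one_mul_choose_eq (m + 1) (M + 1)
      have : (((m + 1 + 1 : ℕ) : ℝ)) * (m + 1).choose (M + 1)
        = (m + 2).choose (M + 2) * ((M + 1 + 1 : ℕ) : ℝ) := by exact_mod_cast this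
      push_cast at this
      linear_combination this
    simp only [binomTerm, show m + 2 - (M + 1 + 1) = m - M by omega]
    field_simp
    linear_combination s ^ M * s ^ 2 * (1 - s) ^ (m - M) * ((m + 2) * c + (M + 1) * c')
  rw [Finset.sum_congr rfl e]
  linarith [binomTerm_nonneg hs.le h1' (m + 2) 0, binomTerm_nonneg hs.le h1' (m + 2) (0 + 1)]

theorem sum_binomTerm_invThreeHalves_le {s : ℝ} (hs : 0 < s) (h1 : s ≤ 1) (m : ℕ) :
    ∑ M ∈ Finset.range (m + 1), binomTerm s (1 - s) m M * invThreeHalves M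
      ≤ (1 / s + 1 / s ^ 2) * invThreeHalves m := by
  have h1' := sub_nonneg.2 h1
  set y := √((m : ℝ) + 1) with hy
  have hy0 : 0 < y := Real.sqrt_pos.2 (by positivity)
  have hy2 : y ^ 2 = m + 1 := Real.sq_sqrt (by positivity)
  -- Interpolates the power `-3/2` between the powers `-1` and `-2`, whose binomial means are
  -- explicit; the weight `y = √(m + 1)` balances the two at the typical size of `M`.
  have pt : ∀ M : ℕ, invThreeHalves M
      ≤ 1 / y * (1 / (M + 1)) + y * (1 / ((M + 1) * (M + 2))) := by
    intro M
    set x := √((M : ℝ) + 1) with hx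
    have hx0 : 0 < x := Real.sqrt_pos.2 (by positivity)
    have hx2 : x ^ 2 = M + 1 := Real.sq_sqrt (by positivity)
    have hx1 : 1 ≤ x ^ 2 := by rw [hx2]; linarith [(Nat.cast_nonneg M : (0 : ℝ) ≤ M)]
    rw [invThreeHalves, ← hx, show (M : ℝ) + 2 = x ^ 2 + 1 by linarith, ← hx2]
    have : 1 / y * (1 / x ^ 2) + y * (1 / (x ^ 2 * (x ^ 2 + 1))) - 1 / (x ^ 2 * x)
        = (x * (x ^ 2 + 1) + y ^ 2 * x - y * (x ^ 2 + 1)) / (y * x ^ 3 * (x ^ 2 + 1)) := by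
      field_simp
    rw [← sub_nonneg, this]
    apply div_nonneg _ (by positivity)
    nlinarith [sq_nonneg (y - x), sq_nonneg (y * x - x ^ 2), mul_pos hx0 hy0,
      mul_nonneg hx0.le (sq_nonneg (y - x)), mul_nonneg hx0.le (sq_nonneg (2 * y - x)),
      mul_nonneg hx0.le (sq_nonneg (2 * y * x - x ^ 2 - 1))]
  have sum : ∑ M ∈ Finset.range (m + 1), binomTerm s (1 - s) m M * invThreeHalves M
      ≤ 1 / y * (1 / (s * (m + 1))) + y * (1 / (s ^ 2 * ((m + 1) * (m + 2)))) := by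
    calc _ ≤ ∑ M ∈ Finset.range (m + 1), (1 / y * (binomTerm s (1 - s) m M * (1 / (M + 1)))
          + y * (binomTerm s (1 - s) m M * (1 / ((M + 1) * (M + 2))))) := by
          refine Finset.sum_le_sum fun M _ => ?_
          have := mul_le_mul_of_nonneg_left (pt M) (binomTerm_nonneg hs.le h1' m M)
          linarith
      _ ≤ _ := by
          rw [Finset.sum_add_distrib, ← Finset.mul_sum, ← Finset.mul_sum]
          gcongr
          · exact sum_binomTerm_div_le hs h1 m
          · exact sum_binomTerm_div_div_le hs h1 m
  refine sum.trans ?_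
  rw [invThreeHalves, ← hy, ← hy2, show (m : ℝ) + 2 = y ^ 2 + 1 by linarith, add_mul]
  refine add_le_add (le_of_eq (by field_simp)) ?_
  calc y * (1 / (s ^ 2 * (y ^ 2 * (y ^ 2 + 1)))) ≤ y * (1 / (s ^ 2 * (y ^ 2 * y ^ 2))) := by
        gcongr
        linarith
    _ = _ := by field_simp

/-- Exponential decay beats the power `-3/2`. -/
theorem exists_pow_le_invThreeHalves {z : ℝ} (h0 : 0 ≤ z) (h1 : z < 1) :
    ∃ K : ℝ, 0 < K ∧ ∀ m : ℕ, z ^ m ≤ K * invThreeHalves m := by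
  obtain ⟨K, hK⟩ := (tendsto_pow_const_mul_const_pow_of_abs_lt_one 2
    (by rwa [abs_of_nonneg h0] : |z| < 1)).bddAbove_range
  refine ⟨4 * (|K| + 1), by positivity, fun m => ?_⟩
  have hm : (m : ℝ) ^ 2 * z ^ m ≤ |K| := (hK ⟨m, rfl⟩).trans (le_abs_self K)
  have hz : z ^ m ≤ 1 := pow_le_one₀ h0 h1.le
  have hz0 : 0 ≤ z ^ m := pow_nonneg h0 m
  have s1 : √((m : ℝ) + 1) ≤ m + 1 := Real.sqrt_le_iff.2 ⟨by positivity, by nlinarith [(Nat.cast_nonneg m : (0 : ℝ) ≤ m)]⟩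
  rw [invThreeHalves, mul_one_div, le_div_iff₀ (by positivity)]
  calc z ^ m * ((m + 1) * √((m : ℝ) + 1)) ≤ z ^ m * ((m + 1) * (m + 1)) := by gcongr
    _ ≤ 2 * (m ^ 2 * z ^ m) + 2 * z ^ m := by nlinarith [mul_nonneg hz0 (sq_nonneg ((m : ℝ) - 1))]
    _ ≤ _ := by linarith [abs_nonneg K]

end Scalars

/-! ### Expansions in two commuting variables -/

section Expansions

variable {R : Type*} [Ring R] [Algebra ℝ R] {x y : R}

theorem sub_mul_add_pow_mul_of_commute (hc : Commute x y) (M d : ℕ) :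
    (y - x) * (x + y) ^ M * (x * y) ^ d
      = ∑ k ∈ Finset.range (M + 2), binomDiff M k • (x ^ (d + k) * y ^ (d + (M + 1 - k))) := by
  have base : (y - x) * (x + y) ^ M
      = ∑ k ∈ Finset.range (M + 2), binomDiff M k • (x ^ k * y ^ (M + 1 - k)) := by
    have hpow : (x + y) ^ M
        = ∑ k ∈ Finset.range (M + 1), (M.choose k : ℝ) • (x ^ k * y ^ (M - k)) := by
      rw [hc.add_pow]
      refine Finset.sum_congr rfl fun k _ => ?_
      rw [← Nat.cast_comm, ← nsmul_eq_mul, Nat.cast_smul_eq_nsmul]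
    have hy : y * (x + y) ^ M
        = ∑ k ∈ Finset.range (M + 2), (M.choose k : ℝ) • (x ^ k * y ^ (M + 1 - k)) := by
      rw [Finset.sum_range_succ, Nat.choose_succ_self, Nat.cast_zero, zero_smul, add_zero, hpow,
        Finset.mul_sum]
      refine Finset.sum_congr rfl fun k hk => ?_
      have hk' : k ≤ M := Nat.lt_succ_iff.1 (Finset.mem_range.1 hk)
      rw [mul_smul_comm, ← mul_assoc, ← (hc.pow_left k).eq, mul_assoc, ← pow_succ',
        Nat.sub_add_comm hk']
    have hx : x * (x + y) ^ M
        = ∑ k ∈ Finset.range (M + 1), (M.choose k : ℝ) • (x ^ (k + 1) * y ^ (M - k)) := by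
      rw [hpow, Finset.mul_sum]
      refine Finset.sum_congr rfl fun k _ => ?_
      rw [mul_smul_comm, ← mul_assoc, ← pow_succ']
    rw [sub_mul, hy, hx, Finset.sum_range_succ', Finset.sum_range_succ' (fun k => binomDiff M k • _),
      add_sub_right_comm, ← Finset.sum_sub_distrib]
    congr 1
    · refine Finset.sum_congr rfl fun k _ => ?_
      rw [Nat.add_sub_add_right, ← sub_smul, binomDiff]
    · simp [binomDiff]
  rw [base, Finset.sum_mul]
  refine Finset.sum_congr rfl fun k _ => ?_
  rw [smul_mul_assoc, hc.mul_pow, mul_assoc, ← mul_assoc (y ^ _), (hc.pow_pow d _).symm.eq,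
    mul_assoc, ← mul_assoc, ← pow_add, ← pow_add, add_comm k d, add_comm (M + 1 - k) d]

theorem add_pow_mul_pow_mul_of_commute (hc : Commute x y) (M d : ℕ) :
    (x + y) ^ M * (x * y) ^ d * y
      = ∑ k ∈ Finset.range (M + 1), (M.choose k : ℝ) • (x ^ (k + d) * y ^ (M - k + d + 1)) := by
  rw [hc.add_pow, Finset.sum_mul, Finset.sum_mul]
  refine Finset.sum_congr rfl fun k _ => ?_
  rw [← Nat.cast_comm, ← nsmul_eq_mul, ← Nat.cast_smul_eq_nsmul ℝ, smul_mul_assoc, smul_mul_assoc,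
    hc.mul_pow, mul_assoc (x ^ k), ← mul_assoc (y ^ _), (hc.pow_pow d _).symm.eq, mul_assoc (x ^ d),
    ← mul_assoc (x ^ k), ← pow_add, ← pow_add, mul_assoc, ← pow_succ]

theorem smul_add_pow_of_commute (hc : Commute x y) (s t w : ℝ) (m : ℕ) :
    (s • (x + y) + (w • 1 + t • (x * y))) ^ m
      = ∑ M ∈ Finset.range (m + 1), ∑ d ∈ Finset.range (m - M + 1),
          (m.choose M * s ^ M * binomTerm t w (m - M) d) • ((x + y) ^ M * (x * y) ^ d) := by
  have c1 : Commute (x + y) (x * y) :=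
    Commute.add_left ((Commute.refl x).mul_right hc) (hc.symm.mul_right (Commute.refl y))
  have c2 : Commute (s • (x + y)) (w • 1 + t • (x * y)) :=
    Commute.smul_left (Commute.add_right ((Commute.one_right _).smul_right w)
      (c1.smul_right t)) s
  have c3 : Commute (t • (x * y)) (w • (1 : R)) := (Commute.one_right _).smul_right w
  rw [c2.add_pow]
  refine Finset.sum_congr rfl fun M _ => ?_
  rw [add_comm (w • (1 : R)), c3.add_pow, Finset.mul_sum, Finset.sum_mul]
  refine Finset.sum_congr rfl fun d _ => ?_
  rw [← Nat.cast_comm, ← Nat.cast_comm, ← nsmul_eq_mul, ← nsmul_eq_mul,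
    ← Nat.cast_smul_eq_nsmul ℝ, ← Nat.cast_smul_eq_nsmul ℝ]
  simp only [smul_pow, one_pow, mul_smul_comm, smul_mul_assoc, mul_one, smul_smul]
  congr 1
  unfold binomTerm
  ring

end Expansions

/-! ### The main estimate for the swap functional -/

section Estimate

variable {ι : Type*} [Fintype ι] {μ : ι → ℝ} (tok : ι → List Bool)

theorem sum_swapDiff_sq_le (hμ : ∀ i, 0 ≤ μ i) (h1 : ∑ i, μ i = 1) {a b : ι} (hab : a ≠ b)
    (n : ℕ) (h : List Bool → ℝ) :
    μ a * μ b * ∑ k ∈ Finset.range n,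
        swapDiff (tok a) (tok b) ((leftAvg μ tok ^ k * rightAvg μ tok ^ (n - 1 - k)) h) ^ 2
      ≤ 4 * iidMean μ tok (n + 1) (h ^ 2) := by
  have bessel := sum_swapDiff_sq_add_le tok hμ h1 hab n h
  have j := sq_sum_mul_le hμ h1 fun i => iidMean μ tok n (leftShift (tok i) h)
  rw [← iidMean_succ] at j
  linarith [sq_nonneg (iidMean μ tok (n + 1) h)]

/-- Cauchy–Schwarz between the coefficients `binomDiff` and the insertions bounded by Bessel. The `M
+ 2d + 1` averaged tokens and the swapped pair make `M + 2(d + 1) + 1` tokens in all. -/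
theorem swapDiff_sub_mul_add_pow_mul_sq_le (hμ : ∀ i, 0 ≤ μ i) (h1 : ∑ i, μ i = 1) {a b : ι}
    (hab : a ≠ b) (M d : ℕ) (h : List Bool → ℝ) :
    μ a * μ b * swapDiff (tok a) (tok b) (((rightAvg μ tok - leftAvg μ tok)
        * (leftAvg μ tok + rightAvg μ tok) ^ M * (leftAvg μ tok * rightAvg μ tok) ^ d) h) ^ 2
      ≤ 8 * 4 ^ M * invThreeHalves M * iidMean μ tok (M + 2 * (d + 1) + 1) (h ^ 2) := by
  set c : ℕ → ℝ := fun k => swapDiff (tok a) (tok b)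
    ((leftAvg μ tok ^ k * rightAvg μ tok ^ (M + 2 * d + 2 - 1 - k)) h) with hcdef
  have expand : swapDiff (tok a) (tok b) (((rightAvg μ tok - leftAvg μ tok)
        * (leftAvg μ tok + rightAvg μ tok) ^ M * (leftAvg μ tok * rightAvg μ tok) ^ d) h)
      = ∑ k ∈ Finset.range (M + 2), binomDiff M k * c (d + k) := by
    rw [sub_mul_add_pow_mul_of_commute (commute_leftAvg_rightAvg μ tok)]
    simp only [LinearMap.sum_apply, LinearMap.smul_apply, map_sum, map_smul, smul_eq_mul]
    refine Finset.sum_congr rfl fun k hk => ?_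
    have hk' : k < M + 2 := Finset.mem_range.1 hk
    rw [hcdef]
    simp only
    rw [show M + 2 * d + 2 - 1 - (d + k) = d + (M + 1 - k) by omega]
  have cs := Finset.sum_mul_sq_le_sq_mul_sq (Finset.range (M + 2)) (binomDiff M)
    (fun k => c (d + k))
  have sub : ∑ k ∈ Finset.range (M + 2), c (d + k) ^ 2
      ≤ ∑ k ∈ Finset.range (M + 2 * d + 2), c k ^ 2 := by
    have e := Finset.sum_Ico_eq_sum_range (fun k => c k ^ 2) d (d + (M + 2))
    rw [Nat.add_sub_cancel_left] at e
    rw [← e]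
    refine Finset.sum_le_sum_of_subset_of_nonneg (fun k hk => ?_) fun k _ _ => sq_nonneg _
    have := Finset.mem_Ico.1 hk
    exact Finset.mem_range.2 (by omega)
  have bessel := sum_swapDiff_sq_le tok hμ h1 hab (M + 2 * d + 2) h
  rw [show M + 2 * d + 2 + 1 = M + 2 * (d + 1) + 1 by ring] at bessel
  have hw : 0 ≤ μ a * μ b := mul_nonneg (hμ a) (hμ b)
  have hi := iidMean_nonneg tok hμ (M + 2 * (d + 1) + 1) (h := h ^ 2) fun s => sq_nonneg (h s)
  have hd := sum_binomDiff_sq_le M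
  have hd0 : 0 ≤ ∑ k ∈ Finset.range (M + 2), binomDiff M k ^ 2 :=
    Finset.sum_nonneg fun k _ => sq_nonneg _
  rw [expand]
  calc _ ≤ μ a * μ b * ((∑ k ∈ Finset.range (M + 2), binomDiff M k ^ 2)
        * ∑ k ∈ Finset.range (M + 2 * d + 2), c k ^ 2) := by
        gcongr
        exact cs.trans (by gcongr)
    _ = (∑ k ∈ Finset.range (M + 2), binomDiff M k ^ 2)
        * (μ a * μ b * ∑ k ∈ Finset.range (M + 2 * d + 2), c k ^ 2) := by ring
    _ ≤ (2 * 4 ^ M * invThreeHalves M) * (4 * iidMean μ tok (M + 2 * (d + 1) + 1) (h ^ 2)) := by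
        refine mul_le_mul hd bessel ?_ (hd0.trans hd)
        exact mul_nonneg hw (Finset.sum_nonneg fun k _ => sq_nonneg _)
    _ = _ := by ring

theorem add_pow_mul_pow_mul_apply_nil (M d : ℕ) (g : List Bool → ℝ) :
    ((leftAvg μ tok + rightAvg μ tok) ^ M * (leftAvg μ tok * rightAvg μ tok) ^ d
      * rightAvg μ tok) g [] = 2 ^ M * iidMean μ tok (M + 2 * d + 1) g := by
  rw [add_pow_mul_pow_mul_of_commute (commute_leftAvg_rightAvg μ tok)]
  simp only [LinearMap.sum_apply, LinearMap.smul_apply, Finset.sum_apply, Pi.smul_apply,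
    smul_eq_mul, leftAvg_pow_rightAvg_pow_nil]
  have e : ∀ k ∈ Finset.range (M + 1),
      (M.choose k : ℝ) * iidMean μ tok (k + d + (M - k + d + 1)) g
        = M.choose k * iidMean μ tok (M + 2 * d + 1) g := by
    intro k hk
    have := Finset.mem_range.1 hk
    rw [show k + d + (M - k + d + 1) = M + 2 * d + 1 by omega]
  rw [Finset.sum_congr rfl e, ← Finset.sum_mul]
  congr 1
  exact_mod_cast Nat.sum_range_choose M

theorem le_half_add_of_sq_le_mul {x u v : ℝ} (hu : 0 ≤ u) (hv : 0 ≤ v) (h : x ^ 2 ≤ u * v) :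
    x ≤ u / 2 + v / 2 := by
  have : x ^ 2 ≤ (u / 2 + v / 2) ^ 2 := by nlinarith [sq_nonneg (u - v)]
  exact le_of_sq_le_sq this (by positivity)

/-- Both sides are expanded over `M` and `d`. The extra `rightAvg` on the right matches the parity
of the token counts, so the term `(M, d)` on the left is paired with the second moment of `(M, d +
1)`. -/
theorem exists_mul_swapDiff_le (hμ : ∀ i, 0 ≤ μ i) (h1 : ∑ i, μ i = 1) {a b : ι} (hab : a ≠ b)
    (ha : 0 < μ a) (hb : 0 < μ b) {s t w c v : ℝ} (hs : 0 < s) (ht : 0 < t) (hw : 0 < w)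
    (hc : 0 < c) (hv : 0 < v) (hstw : 2 * s + t + w = 1) :
    ∃ K : ℝ, 0 < K ∧ ∀ (m : ℕ) (h : List Bool → ℝ), (∀ l, |h l| ≤ 1) →
      c * swapDiff (tok a) (tok b) (((s • (leftAvg μ tok + rightAvg μ tok)
            + (w • 1 + t • (leftAvg μ tok * rightAvg μ tok))) ^ m
          * (rightAvg μ tok - leftAvg μ tok)) h)
        ≤ K * invThreeHalves m + v / 2 * ((s • (leftAvg μ tok + rightAvg μ tok)
            + (w • 1 + t • (leftAvg μ tok * rightAvg μ tok))) ^ m * rightAvg μ tok) (h ^ 2) [] := by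
  obtain ⟨K₁, hK₁, hexp⟩ := exists_pow_le_invThreeHalves (z := 2 * s + t) (by positivity)
    (by linarith)
  have hab0 : 0 < μ a * μ b := mul_pos ha hb
  set B := 8 / (μ a * μ b) with hB
  have hB0 : 0 < B := by positivity
  -- Since `u * v = c² B`, the arithmetic-geometric mean inequality puts exactly the prescribed `v /
  -- 2` before the second moment.
  set u := c ^ 2 * B / v with hu
  have hu0 : 0 < u := by positivity
  set r := 2 * s with hr
  have hr0 : 0 < r := by positivity
  have hr1 : r ≤ 1 := by linarith
  refine ⟨u / 2 * (w / t + 4) * (1 / r + 1 / r ^ 2) + c * √B * K₁, by positivity,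
    fun m h hh => ?_⟩
  set L := leftAvg μ tok
  set Q := rightAvg μ tok
  have hLQ : Commute L Q := commute_leftAvg_rightAvg μ tok
  set A : ℕ → ℕ → ℝ := fun M d => swapDiff (tok a) (tok b)
    (((Q - L) * (L + Q) ^ M * (L * Q) ^ d) h) with hA
  set β : ℕ → ℕ → ℝ := fun M d => iidMean μ tok (M + 2 * d + 1) (h ^ 2) with hβ
  have hh2 : ∀ l, (h ^ 2) l ≤ 1 := fun l => (sq_le_one_iff_abs_le_one _).2 (hh l)
  have β0 : ∀ M d, 0 ≤ β M d := fun M d => iidMean_nonneg tok hμ _ fun l => sq_nonneg (h l)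
  have β1 : ∀ M d, β M d ≤ 1 := fun M d => iidMean_le_one tok hμ h1 _ hh2
  have hAsq : ∀ M d, A M d ^ 2 ≤ 4 ^ M * B * invThreeHalves M * β M (d + 1) := by
    intro M d
    have := swapDiff_sub_mul_add_pow_mul_sq_le tok hμ h1 hab M d h
    have e : 4 ^ M * B * invThreeHalves M * β M (d + 1)
        = (8 * 4 ^ M * invThreeHalves M * β M (d + 1)) / (μ a * μ b) := by rw [hB]; ring
    rw [e, le_div_iff₀ hab0]
    linarith
  have lhs : c * swapDiff (tok a) (tok b)
        (((s • (L + Q) + (w • 1 + t • (L * Q))) ^ m * (Q - L)) h)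
      = ∑ M ∈ Finset.range (m + 1), ∑ d ∈ Finset.range (m - M + 1),
          c * (m.choose M * s ^ M * binomTerm t w (m - M) d * A M d) := by
    have e : (s • (L + Q) + (w • 1 + t • (L * Q))) ^ m * (Q - L)
        = ∑ M ∈ Finset.range (m + 1), ∑ d ∈ Finset.range (m - M + 1),
          (m.choose M * s ^ M * binomTerm t w (m - M) d) • ((Q - L) * (L + Q) ^ M * (L * Q) ^ d) := by
      have cLQ1 : Commute (L + Q) (Q - L) :=
        Commute.sub_right (Commute.add_left hLQ (Commute.refl Q))
          (Commute.add_left (Commute.refl L) hLQ.symm)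
      have cLQ2 : Commute (L * Q) (Q - L) :=
        Commute.sub_right (Commute.mul_left hLQ (Commute.refl Q))
          (Commute.mul_left (Commute.refl L) hLQ.symm)
      rw [smul_add_pow_of_commute hLQ, Finset.sum_mul]
      refine Finset.sum_congr rfl fun M _ => ?_
      rw [Finset.sum_mul]
      refine Finset.sum_congr rfl fun d _ => ?_
      rw [smul_mul_assoc, ((cLQ1.pow_left M).mul_left (cLQ2.pow_left d)).eq, ← mul_assoc (Q - L)]
    rw [e]
    simp only [LinearMap.sum_apply, LinearMap.smul_apply, map_sum, map_smul, smul_eq_mul,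
      Finset.mul_sum, hA]
  have rhs : ((s • (L + Q) + (w • 1 + t • (L * Q))) ^ m * Q) (h ^ 2) []
      = ∑ M ∈ Finset.range (m + 1), ∑ d ∈ Finset.range (m - M + 1),
          m.choose M * r ^ M * binomTerm t w (m - M) d * β M d := by
    rw [smul_add_pow_of_commute hLQ, Finset.sum_mul]
    simp only [Finset.sum_mul, smul_mul_assoc, LinearMap.sum_apply, LinearMap.smul_apply,
      Finset.sum_apply, Pi.smul_apply, smul_eq_mul]
    refine Finset.sum_congr rfl fun M _ => Finset.sum_congr rfl fun d _ => ?_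
    rw [add_pow_mul_pow_mul_apply_nil, hr, mul_pow]
    simp only [hβ]
    ring
  rw [lhs, rhs]
  have row : ∀ M ∈ Finset.range (m + 1), ∑ d ∈ Finset.range (m - M + 1),
      c * (m.choose M * s ^ M * binomTerm t w (m - M) d * A M d)
      ≤ u / 2 * (w / t + 4) * (binomTerm r (1 - r) m M * invThreeHalves M)
        + c * √B * binomTerm r t m M
        + v / 2 * ∑ d ∈ Finset.range (m - M + 1),
          m.choose M * r ^ M * binomTerm t w (m - M) d * β M d := by
    intro M _
    obtain ⟨U, U0, hU, sU⟩ := exists_binomTerm_shift ht hw (m - M)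
    set j := m - M with hj
    have b0 := binomTerm_nonneg ht.le hw.le j
    have κ0 := invThreeHalves_nonneg M
    set C : ℝ := ((m.choose M : ℕ) : ℝ) with hC
    have C0 : 0 ≤ C := Nat.cast_nonneg _
    have r4 : (r ^ M) ^ 2 = (s ^ M) ^ 2 * 4 ^ M := by
      rw [hr, ← pow_mul, mul_comm M 2, pow_mul, ← pow_mul s M, mul_comm M 2, pow_mul, ← mul_pow]
      congr 1
      ring
    have term : ∀ d ∈ Finset.range j, c * (C * s ^ M * binomTerm t w j d * A M d)
        ≤ u / 2 * (C * r ^ M * invThreeHalves M) * U d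
          + v / 2 * (C * r ^ M * binomTerm t w j (d + 1) * β M (d + 1)) := by
      intro d hd
      have hUd := hU d (Finset.mem_range.1 hd)
      have := le_half_add_of_sq_le_mul (x := c * (C * s ^ M * binomTerm t w j d * A M d))
        (u := u * (C * r ^ M * invThreeHalves M) * U d)
        (v := v * (C * r ^ M * binomTerm t w j (d + 1) * β M (d + 1)))
        (mul_nonneg (by positivity) (U0 d))
        (mul_nonneg hv.le (mul_nonneg (mul_nonneg (by positivity) (b0 _)) (β0 _ _)))
        (by
          calc (c * (C * s ^ M * binomTerm t w j d * A M d)) ^ 2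
              = c ^ 2 * C ^ 2 * (s ^ M) ^ 2 * (binomTerm t w j d ^ 2 * A M d ^ 2) := by ring
            _ ≤ c ^ 2 * C ^ 2 * (s ^ M) ^ 2 * ((U d * binomTerm t w j (d + 1))
                * (4 ^ M * B * invThreeHalves M * β M (d + 1))) := by
                refine mul_le_mul_of_nonneg_left ?_ (by positivity)
                exact mul_le_mul hUd (hAsq M d) (sq_nonneg _) (mul_nonneg (U0 d) (b0 _))
            _ = c ^ 2 * B * (C ^ 2 * ((s ^ M) ^ 2 * 4 ^ M) * invThreeHalves M * U d
                * binomTerm t w j (d + 1) * β M (d + 1)) := by ring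
            _ = (u * v) * (C ^ 2 * (r ^ M) ^ 2 * invThreeHalves M * U d
                * binomTerm t w j (d + 1) * β M (d + 1)) := by
                rw [r4, hu, div_mul_cancel₀ _ hv.ne']
            _ = _ := by ring)
      linarith
    -- The top index has no successor. A crude bound suffices: these terms sum to a multiple of `(2s
    -- + t)^m`, exponentially small because `w > 0`.
    have last : c * (C * s ^ M * binomTerm t w j j * A M j) ≤ c * √B * binomTerm r t m M := by
      have hA1 : A M j ≤ 2 ^ M * √B := by
        refine le_of_sq_le_sq ?_ (by positivity)
        rw [mul_pow, Real.sq_sqrt hB0.le, ← pow_mul, mul_comm M 2, pow_mul]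
        refine (hAsq M j).trans ?_
        norm_num
        have i1 : invThreeHalves M * β M (j + 1) ≤ 1 :=
          mul_le_one₀ (invThreeHalves_le_one M) (β0 _ _) (β1 _ _)
        have : 0 ≤ 4 ^ M * B := by positivity
        nlinarith
      have e : binomTerm t w j j = t ^ j := by simp [binomTerm]
      rw [e]
      calc c * (C * s ^ M * t ^ j * A M j) ≤ c * (C * s ^ M * t ^ j * (2 ^ M * √B)) := by gcongr
        _ = _ := by rw [binomTerm, ← hC, hr, mul_pow]; ring
    rw [Finset.sum_range_succ, Finset.sum_range_succ']
    have s1 := Finset.sum_le_sum term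
    rw [Finset.sum_add_distrib, ← Finset.mul_sum, ← Finset.mul_sum, ← Finset.mul_sum] at s1
    rw [← Finset.mul_sum]
    have s2 : u / 2 * (C * r ^ M * invThreeHalves M) * ∑ d ∈ Finset.range j, U d
        ≤ u / 2 * (w / t + 4) * (binomTerm r (1 - r) m M * invThreeHalves M) := by
      calc _ ≤ u / 2 * (C * r ^ M * invThreeHalves M) * ((w / t + 4) * (t + w) ^ j) := by gcongr
        _ = _ := by
          rw [binomTerm, ← hC, show 1 - r = t + w by linarith]
          ring
    have s3 : 0 ≤ v / 2 * (C * r ^ M * binomTerm t w j 0 * β M 0) :=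
      mul_nonneg (by positivity) (mul_nonneg (mul_nonneg (by positivity) (b0 0)) (β0 M 0))
    linarith
  refine (Finset.sum_le_sum row).trans ?_
  rw [Finset.sum_add_distrib, Finset.sum_add_distrib, ← Finset.mul_sum, ← Finset.mul_sum,
    ← Finset.mul_sum, sum_binomTerm]
  have f1 := sum_binomTerm_invThreeHalves_le hr0 hr1 m
  have f2 := hexp m
  have g1 := mul_le_mul_of_nonneg_left f1 (by positivity : 0 ≤ u / 2 * (w / t + 4))
  have g2 := mul_le_mul_of_nonneg_left f2 (by positivity : 0 ≤ c * √B)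
  linarith

end Estimate

/-! ### The defect strings in terms of block operators -/

theorem zeroOne_succ (k : ℕ) : zeroOne (k + 1) = [false, true] ++ zeroOne k := by
  simp [zeroOne, List.replicate_succ]

theorem zeroOne_add (a b : ℕ) : zeroOne (a + b) = zeroOne a ++ zeroOne b := by
  simp only [zeroOne, List.replicate_add, List.flatten_append]

theorem defectList_ne (m : ℕ) (U : List Bool) :
    defectList m (m + 1) ++ U ≠ defectList (m + 1) m ++ U := by
  intro h
  have h' := List.append_cancel_right h
  rw [defectList, defectList, zeroOne_add m 1, List.append_assoc, List.append_assoc,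
    List.append_assoc] at h'
  have := List.append_cancel_left h'
  simp [zeroOne] at this

section Blocks

variable {q : ℝ}

/-- The nonempty outcomes `0`, `1`, `01` of a block `01`. -/
def blockTok : Fin 3 → List Bool := ![[false], [true], [false, true]]

/-- The conditional distribution of the outcome of a block `01`, given that it is nonempty. -/
noncomputable def blockProb (q : ℝ) : Fin 3 → ℝ :=
  ![(1 - q) * q / (1 - q ^ 2), (1 - q) * q / (1 - q ^ 2), (1 - q) ^ 2 / (1 - q ^ 2)]

theorem one_sub_sq_pos (h0 : 0 < q) (h1 : q < 1) : 0 < 1 - q ^ 2 := by nlinarith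

theorem blockProb_pos (h0 : 0 < q) (h1 : q < 1) (i : Fin 3) : 0 < blockProb q i := by
  have hr := one_sub_sq_pos h0 h1
  have hp := sub_pos.2 h1
  fin_cases i <;> simp [blockProb] <;> positivity

theorem sum_blockProb (h0 : 0 < q) (h1 : q < 1) : ∑ i, blockProb q i = 1 := by
  have hr := (one_sub_sq_pos h0 h1).ne'
  simp only [Fin.sum_univ_three, blockProb, Matrix.cons_val]
  field_simp
  ring

/-- Averaging over the trace of a block `01` put in front. -/
noncomputable def leftBlock (q : ℝ) : Module.End ℝ (List Bool → ℝ) :=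
  q ^ 2 • 1 + (1 - q ^ 2) • leftAvg (blockProb q) blockTok

/-- Averaging over the trace of a block `01` put at the end. -/
noncomputable def rightBlock (q : ℝ) : Module.End ℝ (List Bool → ℝ) :=
  q ^ 2 • 1 + (1 - q ^ 2) • rightAvg (blockProb q) blockTok

theorem leftBlock_apply (h0 : 0 < q) (h1 : q < 1) (h : List Bool → ℝ) (s : List Bool) :
    leftBlock q h s = q ^ 2 * h s + (1 - q) * q * h (false :: s) + (1 - q) * q * h (true :: s)
      + (1 - q) ^ 2 * h (false :: true :: s) := by
  have hr := (one_sub_sq_pos h0 h1).ne'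
  simp only [leftBlock, LinearMap.add_apply, LinearMap.smul_apply, Module.End.one_apply,
    Pi.add_apply, Pi.smul_apply, smul_eq_mul, leftAvg_apply, Fin.sum_univ_three, blockProb,
    blockTok, Matrix.cons_val, List.cons_append, List.nil_append]
  field_simp
  ring

theorem rightBlock_apply (h0 : 0 < q) (h1 : q < 1) (h : List Bool → ℝ) (s : List Bool) :
    rightBlock q h s = q ^ 2 * h s + (1 - q) * q * h (s ++ [false])
      + (1 - q) * q * h (s ++ [true]) + (1 - q) ^ 2 * h (s ++ [false, true]) := by
  have hr := (one_sub_sq_pos h0 h1).ne'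
  simp only [rightBlock, LinearMap.add_apply, LinearMap.smul_apply, Module.End.one_apply,
    Pi.add_apply, Pi.smul_apply, smul_eq_mul, rightAvg_apply, Fin.sum_univ_three, blockProb,
    blockTok, Matrix.cons_val]
  field_simp
  ring

theorem commute_leftBlock_rightBlock (q : ℝ) : Commute (leftBlock q) (rightBlock q) := by
  have c := commute_leftAvg_rightAvg (blockProb q) blockTok
  exact Commute.add_left ((Commute.one_left _).smul_left _)
    (Commute.add_right ((Commute.one_right _).smul_right _)
      ((c.smul_right _).smul_left _) |>.trans rfl)

theorem traceMean_block_append (h0 : 0 < q) (h1 : q < 1) (U : List Bool) (h : List Bool → ℝ) :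
    traceMean q ([false, true] ++ U) h = traceMean q U (leftBlock q h) := by
  have e : leftBlock q h = q ^ 2 • h + ((1 - q) * q) • (fun s => h (false :: s))
      + ((1 - q) * q) • (fun s => h (true :: s))
      + ((1 - q) ^ 2) • (fun s => h (false :: true :: s)) := by
    ext s
    simp [leftBlock_apply h0 h1]
  rw [e]
  simp only [List.cons_append, List.nil_append, traceMean_cons, map_add, map_smul, smul_eq_mul]
  ring

theorem traceMean_append_block (h0 : 0 < q) (h1 : q < 1) (U : List Bool) (h : List Bool → ℝ) :
    traceMean q (U ++ [false, true]) h = traceMean q U (rightBlock q h) := by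
  rw [traceMean_append]
  congr 1
  ext s
  rw [rightBlock_apply h0 h1]
  simp only [traceMean_cons, traceMean_nil, List.append_nil]
  ring

theorem traceMean_zeroOne_append (h0 : 0 < q) (h1 : q < 1) (k : ℕ) (U : List Bool)
    (h : List Bool → ℝ) :
    traceMean q (zeroOne k ++ U) h = traceMean q U ((leftBlock q ^ k) h) := by
  induction k generalizing h with
  | zero => simp [zeroOne]
  | succ k ih =>
    rw [zeroOne_succ, List.append_assoc, traceMean_block_append h0 h1, ih, pow_succ,
      Module.End.mul_apply]

theorem traceMean_append_zeroOne (h0 : 0 < q) (h1 : q < 1) (k : ℕ) (U : List Bool)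
    (h : List Bool → ℝ) :
    traceMean q (U ++ zeroOne k) h = traceMean q U ((rightBlock q ^ k) h) := by
  induction k generalizing h with
  | zero => simp [zeroOne]
  | succ k ih =>
    have e : zeroOne (k + 1) = zeroOne k ++ [false, true] := by
      rw [zeroOne_add]; simp [zeroOne]
    rw [e, ← List.append_assoc, traceMean_append_block h0 h1, ih, pow_succ, Module.End.mul_apply]

/-- The first term is what a block `01` in place of the defect would give; the correction comes from
the event that both defect bits survive. -/
theorem traceMean_defectList (h0 : 0 < q) (h1 : q < 1) (a b : ℕ) (h : List Bool → ℝ) :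
    traceMean q (defectList a b) h
      = (leftBlock q * leftBlock q ^ a * rightBlock q ^ b) h []
        + (1 - q) ^ 2 * swapDiff [false] [true] ((leftBlock q ^ a * rightBlock q ^ b) h) := by
  rw [defectList, traceMean_append_zeroOne h0 h1, traceMean_zeroOne_append h0 h1, mul_assoc,
    ← Module.End.mul_apply, Module.End.mul_apply (leftBlock q), leftBlock_apply h0 h1,
    swapDiff_apply]
  simp only [traceMean_cons, traceMean_nil, List.cons_append, List.nil_append]
  ring

theorem rightBlock_apply_nil (h0 : 0 < q) (h1 : q < 1) (h : List Bool → ℝ) :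
    rightBlock q h [] = leftBlock q h [] := by
  rw [rightBlock_apply h0 h1, leftBlock_apply h0 h1]
  simp

/-- The main terms cancel, both being the mean for the defect-free string of the same length. -/
theorem traceMean_defectList_sub (h0 : 0 < q) (h1 : q < 1) (m : ℕ) (h : List Bool → ℝ) :
    traceMean q (defectList m (m + 1)) h - traceMean q (defectList (m + 1) m) h
      = (1 - q) ^ 2 * (1 - q ^ 2) * swapDiff [false] [true] (((leftBlock q * rightBlock q) ^ m
        * (rightAvg (blockProb q) blockTok - leftAvg (blockProb q) blockTok)) h) := by
  have hc := commute_leftBlock_rightBlock q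
  have e1 : (leftBlock q * leftBlock q ^ m * rightBlock q ^ (m + 1)) h []
      = (leftBlock q * leftBlock q ^ (m + 1) * rightBlock q ^ m) h [] := by
    rw [← pow_succ', pow_succ' (rightBlock q), ← mul_assoc, (hc.pow_left (m + 1)).eq, mul_assoc,
      Module.End.mul_apply, rightBlock_apply_nil h0 h1, ← Module.End.mul_apply, ← mul_assoc]
  have e2 : leftBlock q ^ m * rightBlock q ^ (m + 1) - leftBlock q ^ (m + 1) * rightBlock q ^ m
      = (1 - q ^ 2) • ((leftBlock q * rightBlock q) ^ m
        * (rightAvg (blockProb q) blockTok - leftAvg (blockProb q) blockTok)) := by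
    have : (1 - q ^ 2) • (rightAvg (blockProb q) blockTok - leftAvg (blockProb q) blockTok)
        = rightBlock q - leftBlock q := by
      rw [leftBlock, rightBlock, smul_sub]; abel
    rw [← mul_smul_comm, this, mul_sub, hc.mul_pow, mul_assoc, ← pow_succ, mul_assoc,
      ← (hc.pow_right m).eq, ← mul_assoc, ← pow_succ]
  rw [traceMean_defectList h0 h1, traceMean_defectList h0 h1, e1, add_sub_add_left_eq_sub,
    ← mul_sub, ← map_sub, ← LinearMap.sub_apply, e2, LinearMap.smul_apply, map_smul, smul_eq_mul,
    mul_assoc]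

theorem leftBlock_mul_rightBlock (q : ℝ) :
    leftBlock q * rightBlock q
      = ((1 - q ^ 2) * q ^ 2) • (leftAvg (blockProb q) blockTok + rightAvg (blockProb q) blockTok)
        + (q ^ 4 • 1 + (1 - q ^ 2) ^ 2 •
          (leftAvg (blockProb q) blockTok * rightAvg (blockProb q) blockTok)) := by
  simp only [leftBlock, rightBlock, add_mul, mul_add, smul_mul_assoc, mul_smul_comm, one_mul,
    mul_one, smul_smul, smul_add]
  module

/-- Deleting a bit on purpose costs at most a factor `q`. -/
theorem mul_traceMean_append_le (h0 : 0 ≤ q) (h1 : q ≤ 1) (A : List Bool) (c : Bool)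
    (B : List Bool) {h : List Bool → ℝ} (hh : ∀ s, 0 ≤ h s) :
    q * traceMean q (A ++ B) h ≤ traceMean q (A ++ c :: B) h := by
  rw [traceMean_append, traceMean_append, ← smul_eq_mul, ← map_smul]
  refine traceMean_mono h0 h1 A fun s => ?_
  rw [traceMean_cons]
  have := mul_nonneg (sub_nonneg.2 h1) (traceMean_nonneg h0 h1 B (h := fun u => h (s ++ c :: u))
    fun u => hh _)
  simp only [Pi.smul_apply, smul_eq_mul]
  linarith

theorem sq_mul_traceMean_zeroOne_le (h0 : 0 ≤ q) (h1 : q ≤ 1) (a b : ℕ) (U : List Bool)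
    {h : List Bool → ℝ} (hh : ∀ s, 0 ≤ h s) :
    q ^ 2 * traceMean q (zeroOne (a + b) ++ U) h ≤ traceMean q (defectList a b ++ U) h := by
  have e1 := mul_traceMean_append_le h0 h1 (zeroOne a) true (false :: (zeroOne b ++ U)) hh
  have e2 := mul_traceMean_append_le h0 h1 (zeroOne a) false (zeroOne b ++ U) hh
  have e3 := mul_le_mul_of_nonneg_left e2 h0
  simp only [defectList, zeroOne_add, List.append_assoc, List.cons_append, List.nil_append]
  linarith

/-- Deleting the defect costs `q ^ 2`, and asking the last block to leave a nonempty trace costs `1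
- q ^ 2`. -/
theorem mul_leftBlock_mul_rightBlock_le (h0 : 0 < q) (h1 : q < 1) (m : ℕ) {h : List Bool → ℝ}
    (hh : ∀ s, 0 ≤ h s) :
    q ^ 2 * (1 - q ^ 2) * ((leftBlock q * rightBlock q) ^ m
        * rightAvg (blockProb q) blockTok) h []
      ≤ traceMean q (defectList m (m + 1)) h := by
  have hc := commute_leftBlock_rightBlock q
  have base := sq_mul_traceMean_zeroOne_le h0.le h1.le m (m + 1) [] hh
  rw [List.append_nil, List.append_nil, zeroOne_add, traceMean_append_zeroOne h0 h1,
    ← List.append_nil (zeroOne m), traceMean_zeroOne_append h0 h1, traceMean_nil,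
    ← Module.End.mul_apply] at base
  have e : leftBlock q ^ m * rightBlock q ^ (m + 1)
      = q ^ 2 • (leftBlock q ^ m * rightBlock q ^ m)
        + (1 - q ^ 2) • ((leftBlock q * rightBlock q) ^ m * rightAvg (blockProb q) blockTok) := by
    rw [hc.mul_pow, pow_succ, ← mul_assoc]
    conv_lhs => rw [rightBlock.eq_1 q]
    rw [mul_add, mul_smul_comm, mul_one, mul_smul_comm, ← rightBlock.eq_1 q]
  have nn : 0 ≤ (leftBlock q ^ m * rightBlock q ^ m) h [] := by
    have := traceMean_nonneg h0.le h1.le (zeroOne m ++ zeroOne m) hh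
    rwa [traceMean_append_zeroOne h0 h1, ← List.append_nil (zeroOne m),
      traceMean_zeroOne_append h0 h1, traceMean_nil, ← Module.End.mul_apply] at this
  rw [e] at base
  simp only [LinearMap.add_apply, LinearMap.smul_apply, Pi.add_apply, Pi.smul_apply,
    smul_eq_mul] at base
  have := mul_nonneg (mul_nonneg (sq_nonneg q) (sq_nonneg q)) nn
  linarith

theorem exists_traceClose_defectList (h0 : 0 < q) (h1 : q < 1) :
    ∃ K : ℝ, 0 < K ∧ ∀ m : ℕ,
      TraceClose q (K * invThreeHalves m) (defectList m (m + 1)) (defectList (m + 1) m) := by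
  have hr := one_sub_sq_pos h0 h1
  have hp := sub_pos.2 h1
  have hb := blockProb_pos h0 h1
  -- `s`, `t`, `w` come from `leftBlock_mul_rightBlock`, and `2s + t + w = 1` is the square of `(1 -
  -- q²) + q² = 1`. The value of `v` is the mass found in `mul_leftBlock_mul_rightBlock_le`.
  obtain ⟨K, hK, key⟩ := exists_mul_swapDiff_le blockTok (fun i => (hb i).le)
    (sum_blockProb h0 h1) (a := 0) (b := 1) (by decide) (hb 0) (hb 1)
    (s := (1 - q ^ 2) * q ^ 2) (t := (1 - q ^ 2) ^ 2) (w := q ^ 4) (c := (1 - q) ^ 2 * (1 - q ^ 2))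
    (v := q ^ 2 * (1 - q ^ 2)) (by positivity) (by positivity) (by positivity) (by positivity)
    (by positivity) (by ring)
  refine ⟨K, hK, fun m h hh => ?_⟩
  have k := key m h hh
  rw [← leftBlock_mul_rightBlock] at k
  have l := mul_leftBlock_mul_rightBlock_le h0 h1 m (h := h ^ 2) fun s => sq_nonneg (h s)
  rw [traceMean_defectList_sub h0 h1]
  have e : traceMean q (defectList m (m + 1)) (h ^ 2)
    = traceMean q (defectList m (m + 1)) (fun s => h s ^ 2) := rfl
  rw [← e]
  simp only [blockTok, Matrix.cons_val_zero, Matrix.cons_val_one] at k l ⊢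
  linarith

end Blocks

/-! ### From closeness to the bound on the number of traces -/

theorem ofFn_getD {l : List Bool} {n : ℕ} (hl : l.length = n) :
    List.ofFn (fun i : Fin n => l.getD i false) = l := by
  subst hl
  apply List.ext_getElem
  · simp
  · intro i h1 h2
    simp

/-- The only place where the order `n ^ (3/2)` is given up for the smaller one of the theorem. -/
theorem rpow_div_sqrt_log_le {n : ℕ} (hn : 2 ≤ n) :
    (n : ℝ) ^ (5 / 4 : ℝ) / √(Real.log n) ≤ n * √n / √(Real.log 2) := by
  have h2 : (2 : ℝ) ≤ n := by exact_mod_cast hn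
  have l2 : 0 < Real.log 2 := Real.log_pos (by norm_num)
  have e : (n : ℝ) * √n = (n : ℝ) ^ (3 / 2 : ℝ) := by
    rw [Real.sqrt_eq_rpow, ← Real.rpow_one_add' (by linarith) (by norm_num)]
    norm_num
  rw [e]
  refine div_le_div₀ (by positivity) ?_ (Real.sqrt_pos.2 l2) ?_
  · exact Real.rpow_le_rpow_of_exponent_le (by linarith) (by norm_num)
  · exact Real.sqrt_le_sqrt (Real.log_le_log (by norm_num) h2)

theorem ceil_le_of_canDistinguish {q κ K c₀ ε : ℝ} (h0 : 0 < q) (h1 : q < 1) {n T N : ℕ}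
    {x y : BitString N} {X Y W : List Bool} (hX : List.ofFn x = X) (hY : List.ofFn y = Y)
    (hXY : X ≠ Y) (hc : TraceClose q κ X Y)
    (hx : ∀ h : List Bool → ℝ, (∀ s, 0 ≤ h s) → q ^ 2 * traceMean q W h ≤ traceMean q X h)
    (hy : ∀ h : List Bool → ℝ, (∀ s, 0 ≤ h s) → q ^ 2 * traceMean q W h ≤ traceMean q Y h)
    (hK : 0 < K) (hn : 2 ≤ n) (hnκ : n * √n * κ ≤ K)
    (hε : ε ≤ 1 / 2) (hε0 : 0 < ε) (hc₀ : 0 ≤ c₀)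
    (hlog : c₀ * Real.log (1 / ε) ≤ - Real.log (4 * ε * (1 - ε)))
    (hT : CanDistinguish q x y T ε) :
    ⌈c₀ * q ^ 2 * √(Real.log 2) / (2 * K) * Real.log (1 / ε) * (n : ℝ) ^ (5 / 4 : ℝ)
      / √(Real.log n)⌉₊ ≤ T := by
  subst hX hY
  have main := le_mul_of_canDistinguish h0.le h1.le (by positivity : 0 < q ^ 2)
    (fun e => hXY (by rw [e])) hc W hx hy hε hT
  have l2 : 0 < √(Real.log 2) := Real.sqrt_pos.2 (Real.log_pos (by norm_num))
  have lε : 0 ≤ Real.log (1 / ε) :=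
    Real.log_nonneg (by rw [le_div_iff₀ hε0]; linarith)
  rw [Nat.ceil_le, mul_div_assoc]
  have T0 : (0 : ℝ) ≤ T := Nat.cast_nonneg T
  calc _ ≤ c₀ * q ^ 2 * √(Real.log 2) / (2 * K) * Real.log (1 / ε)
        * (n * √n / √(Real.log 2)) := by
        exact mul_le_mul_of_nonneg_left (rpow_div_sqrt_log_le hn) (by positivity)
    _ = (c₀ * Real.log (1 / ε)) * (q ^ 2 / (2 * K) * (n * √n)) := by field_simp
    _ ≤ (2 * T * (κ / q ^ 2)) * (q ^ 2 / (2 * K) * (n * √n)) := by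
        exact mul_le_mul_of_nonneg_right (hlog.trans main) (by positivity)
    _ = T * (n * √n * κ / K) := by field_simp
    _ ≤ T * 1 := by
        gcongr
        exact div_le_one_of_le₀ hnκ hK.le
    _ = T := mul_one _

end TraceReconstruction

open TraceReconstruction in
theorem theorem1 (q : ℝ) (hq0 : 0 < q) (hq1 : q < 1) (ε₀ : ℝ) (hε₀ : 0 < ε₀) (hε₀' : ε₀ < 1 / 2) :
    ∃ c : ℝ, 0 < c ∧ ∀ ε : ℝ, 0 < ε → ε ≤ ε₀ → ∀ n : ℕ, 2 ≤ n →
      (∀ T : ℕ, TraceReconstruction.CanDistinguish q (TraceReconstruction.xString n)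
          (TraceReconstruction.yString n) T ε →
        ⌈c * Real.log (1 / ε) * (n : ℝ) ^ (5 / 4 : ℝ) / Real.sqrt (Real.log n)⌉₊ ≤ T) ∧
      (∀ T : ℕ, TraceReconstruction.CanReconstruct q n T ε →
        ⌈c * Real.log (1 / ε) * (n : ℝ) ^ (5 / 4 : ℝ) / Real.sqrt (Real.log n)⌉₊ ≤ T) := by
  obtain ⟨K, hK, close⟩ := exists_traceClose_defectList hq0 hq1
  obtain ⟨c₀, hc₀, hlog⟩ := exists_mul_log_le hε₀ hε₀'
  have l2 : 0 < √(Real.log 2) := Real.sqrt_pos.2 (Real.log_pos (by norm_num))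
  -- `21 * K` covers lengths at least four, through `n ≤ 7(m + 1)` and `√n ≤ 3√(m + 1)`; `12 = 3 * 2
  -- * 2` covers `n ≤ 3` with the trivial closeness `2`.
  refine ⟨c₀ * q ^ 2 * √(Real.log 2) / (2 * (21 * K + 12)), by positivity,
    fun ε hε hle n hn => ⟨fun T hT => ?_, fun T hT => ?_⟩⟩
  · obtain ⟨m, rfl⟩ : ∃ m, n = m + 1 := ⟨n - 1, by omega⟩
    have hX : List.ofFn (xString (m + 1)) = defectList m (m + 1) := ofFn_xString (by omega)
    have hY : List.ofFn (yString (m + 1)) = defectList (m + 1) m := ofFn_yString (by omega)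
    refine ceil_le_of_canDistinguish hq0 hq1 hX hY
      (by simpa using defectList_ne m []) (close m) (W := zeroOne (m + (m + 1)))
      (fun h hh => ?_) (fun h hh => ?_) (by positivity) hn ?_ (by linarith) hε hc₀.le
      (hlog ε hε hle) hT
    · simpa using sq_mul_traceMean_zeroOne_le hq0.le hq1.le m (m + 1) [] hh
    · rw [add_comm]
      simpa using sq_mul_traceMean_zeroOne_le hq0.le hq1.le (m + 1) m [] hh
    · rw [invThreeHalves]
      push_cast
      have : ((m : ℝ) + 1) * √((m : ℝ) + 1) * (K * (1 / ((m + 1) * √((m : ℝ) + 1)))) = K := by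
        have : √((m : ℝ) + 1) ≠ 0 := (Real.sqrt_pos.2 (by positivity)).ne'
        field_simp
      rw [this]
      linarith
  · have dist : ∀ x y : BitString n, CanDistinguish q x y T ε := fun x y => by
      obtain ⟨G, hG⟩ := hT
      exact ⟨G, hG x, hG y⟩
    rcases lt_or_ge n 4 with hn4 | hn4
    · set U : List Bool := List.replicate (n - 2) false with hU
      have lX : ([false, true] ++ U).length = n := by simp [hU]; omega
      have lY : ([true, false] ++ U).length = n := by simp [hU]; omega
      refine ceil_le_of_canDistinguish hq0 hq1 (ofFn_getD lX) (ofFn_getD lY) (by simp)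
        (traceClose_two hq0.le hq1.le _ _) (W := U)
        (fun h hh => ?_) (fun h hh => ?_) (by positivity) hn ?_ (by linarith) hε hc₀.le
        (hlog ε hε hle) (dist _ _)
      · have e1 := mul_traceMean_append_le hq0.le hq1.le [] false (true :: U) hh
        have e2 := mul_traceMean_append_le hq0.le hq1.le [] true U hh
        have e3 := mul_le_mul_of_nonneg_left e2 hq0.le
        simp only [List.nil_append, List.cons_append] at e1 e2 e3 ⊢
        linarith
      · simpa [defectList, zeroOne] using sq_mul_traceMean_zeroOne_le hq0.le hq1.le 0 0 U hh
      · have n3 : (n : ℝ) ≤ 3 := by exact_mod_cast (by omega : n ≤ 3)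
        have s2 : √(n : ℝ) ≤ 2 := Real.sqrt_le_iff.2 ⟨by norm_num, by linarith⟩
        have : (n : ℝ) * √n ≤ 3 * 2 := by gcongr
        linarith
    -- The defect strings have length divisible by four; up to three zeros appended to both reach
    -- any length.
    · obtain ⟨m, r, hr, rfl⟩ : ∃ m r, r < 4 ∧ n = 4 * (m + 1) + r :=
        ⟨n / 4 - 1, n % 4, Nat.mod_lt _ (by norm_num), by omega⟩
      set U : List Bool := List.replicate r false with hU
      have lX : (defectList m (m + 1) ++ U).length = 4 * (m + 1) + r := by
        simp [hU, length_defectList]; ring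
      have lY : (defectList (m + 1) m ++ U).length = 4 * (m + 1) + r := by
        simp [hU, length_defectList]; ring
      have κ0 : 0 ≤ K * invThreeHalves m := mul_nonneg hK.le (invThreeHalves_nonneg m)
      refine ceil_le_of_canDistinguish hq0 hq1 (ofFn_getD lX) (ofFn_getD lY) (defectList_ne m U)
        ((close m).append hq0.le hq1.le U) (W := zeroOne (m + (m + 1)) ++ U)
        (fun h hh => ?_) (fun h hh => ?_) (by positivity) hn ?_ (by linarith) hε hc₀.le
        (hlog ε hε hle) (dist _ _)
      · exact sq_mul_traceMean_zeroOne_le hq0.le hq1.le m (m + 1) U hh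
      · rw [add_comm m]
        exact sq_mul_traceMean_zeroOne_le hq0.le hq1.le (m + 1) m U hh
      · have hr' : (r : ℝ) ≤ 3 := by exact_mod_cast (by omega : r ≤ 3)
        have m0 : (0 : ℝ) ≤ m := Nat.cast_nonneg m
        have n7 : ((4 * (m + 1) + r : ℕ) : ℝ) ≤ 7 * (m + 1) := by push_cast; linarith
        have s7 : √((4 * (m + 1) + r : ℕ) : ℝ) ≤ 3 * √((m : ℝ) + 1) := by
          refine Real.sqrt_le_iff.2 ⟨by positivity, ?_⟩
          rw [mul_pow, Real.sq_sqrt (by positivity)]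
          linarith
        have hs : √((m : ℝ) + 1) ≠ 0 := (Real.sqrt_pos.2 (by positivity)).ne'
        calc _ ≤ (7 * ((m : ℝ) + 1)) * (3 * √((m : ℝ) + 1)) * (K * invThreeHalves m) := by gcongr
          _ = 21 * K := by rw [invThreeHalves]; field_simp; norm_num
          _ ≤ _ := by linarith
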